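/- **Notation.** Fix $n$. Let $\mathrm{Sym}(n)$ be the real symmetric $n\times n$ matrices, $\mathcal P=\{P\in \mathrm{Sym}(n): P\ge 0\}$, $\mathcal N=(-\infty,0]$, and $\mathcal J^2=\mathbb R\times\mathbb R^n\times \mathrm{Sym}(n)$. A *subequation* is a nonempty proper subset $\mathcal F\subset\mathcal J^2$ with (P) $(r,p,A)\in\mathcal F,\ P\ge0\Rightarrow (r,p,A+P)\in\mathcal F$; (N) $(r,p,A)\in\mathcal F,\ s\le 0\Rightarrow(r+s,p,A)\in\mathcal F$; (T) $\mathcal F=\overline{\mathrm{Int}\,\mathcal F}$. The Dirichlet dual of $\mathcal F\subset\mathcal J^2$ is $\widetilde{\mathcal F}=\mathcal J^2\setminus(-\mathrm{Int}\,\mathcal F)$. A *monotonicity cone subequation* is a closed convex cone $\mathcal M\subset\mathcal J^2$ with vertex at the origin that contains $\mathcal N\times\{0\}\times\mathcal P$ and satisfies (T); $\mathcal F$ is *$\mathcal M$-monotone* if $\mathcal F+\mathcal M\subset\mathcal F$. A *directional cone* is a closed convex cone $\mathcal D\subset\mathbb R^n$ with vertex at the origin and nonempty interior (possibly $\mathcal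 D=\mathbb R^n$). For $\gamma\in[0,\infty)$, $R\in(0,\infty)$ and a directional cone $\mathcal D$ put $$\mathcal M(\gamma,\mathcal D,R)=\{(r,p,A): r\le-\gamma|p|,\ p\in\mathcal D,\ A\ge\tfrac{|p|}{R}I\},\qquad \mathcal M(\gamma,\mathcal D,\mathcal P)=\{(r,p,A): r\le-\gamma|p|,\ p\in\mathcal D,\ A\ge0\}.$$ For $S\subset\mathbb R^n$, $\mathrm{USC}(S)$ is the set of upper semicontinuous $u:S\to[-\infty,\infty)$. For $\Omega\subset\mathbb R^n$ open and $u\in\mathrm{USC}(\Omega)$, $u$ is *$\mathcal F$-subharmonic on $\Omega$* if for all $x_0\in\Omega$ and every $\varphi$ that is $C^2$ near $x_0$ with $u\le\varphi$ near $x_0$ and $u(x_0)=\varphi(x_0)$, one has $(\varphi(x_0),D\varphi(x_0),D^2\varphi(x_0))\in\mathcal F$. For $\Omega$ bounded and open, *comparison holds for $\mathcal F$ on $\overline\Omega$* if for all $u,v\in \mathrm{USC}(\overline\Omega)$ that are respectively $\mathcal F$- and $\widetilde{\mathcal F}$-subharmonic on $\Omega$, $$u+v\le0\ \text{on}\ \partial\Omega\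 \Longrightarrow\ u+v\le 0\ \text{on}\ \Omega;$$ *(ZMP) holds for $\mathcal G\subset\mathcal J^2$ on $\overline\Omega$* if for all $z\in \mathrm{USC}(\overline\Omega)$ that are $\mathcal G$-subharmonic on $\Omega$, $z\le0$ on $\partial\Omega$ implies $z\le0$ on $\Omega$. **Theorem (Fundamental Family Comparison Theorem, with the zero maximum principle for the fundamental family).** (A) Let $\mathcal M$ be a monotonicity cone subequation and $\mathcal F$ an $\mathcal M$-monotone subequation. 1. If $\mathcal M\supset\mathcal M(\gamma,\mathcal D,R)$ for some $\gamma\in[0,\infty)$, directional cone $\mathcal D$ and $R\in(0,\infty)$, then comparison holds for $\mathcal F$ on $\overline\Omega$ for every open $\Omega$ contained in a translate of $\mathcal D\cap B_R(0)$. 2. If $\mathcal M\supset\mathcal M(\gamma,\mathcal D,\mathcal P)$ for some $\gamma\in[0,\infty)$ and directional cone $\mathcal D$, then comparison holds for $\mathcal F$ on $\overline\Omega$ for every bounded open $\Omega\subset\mathbb R^n$. (B) Every monotonicity cone subequation $\mathcal M$ contains some $\mathcal M(\gamma,\mathcal D,R)$ with $\gamma,R\in(0,\infty)$ and $\mathcal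 D$ a directional cone, so case 1 always applies. Moreover $\mathcal M(\gamma,\mathcal D,R)\subset\mathcal M(\gamma,\mathcal D,\mathcal P)$ for all $\gamma\in[0,\infty)$, $R\in(0,\infty)$ and directional cones $\mathcal D$. (C) Let $\gamma\in[0,\infty)$, let $\mathcal D$ be a directional cone, and let $\mathcal M\subset\mathcal J^2$. 1. If $\mathcal M\supset\mathcal M(\gamma,\mathcal D,R)$ with $R\in(0,\infty)$ (in particular for $\mathcal M=\mathcal M(\gamma,\mathcal D,R)$), then (ZMP) holds for $\widetilde{\mathcal M}$ on $\overline\Omega$ for every open $\Omega$ contained in a translate of $\mathcal D\cap B_R(0)$. 2. If $\mathcal M\supset\mathcal M(\gamma,\mathcal D,\mathcal P)$ (in particular for $\mathcal M=\mathcal M(\gamma,\mathcal D,\mathcal P)$), then (ZMP) holds for $\widetilde{\mathcal M}$ on $\overline\Omega$ for every bounded open $\Omega\subset\mathbb R^n$. -/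

import Mathlib

open Topology

/-- The space `Sym(n)` of real symmetric `n × n` matrices. -/
def SymMat (n : ℕ) : Submodule ℝ (Matrix (Fin n) (Fin n) ℝ) where
  carrier := {A | A.IsSymm}
  zero_mem' := Matrix.isSymm_zero
  add_mem' := fun hA hB => Matrix.IsSymm.add hA hB
  smul_mem' := fun c _ hA => Matrix.IsSymm.smul hA c

/-- The space `𝒥² = ℝ × ℝⁿ × Sym(n)` of 2-jets `(r, p, A)`, with its product topology and
product vector space structure. -/
abbrev Jet (n : ℕ) : Type := ℝ × EuclideanSpace ℝ (Fin n) × SymMat n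

/-- A cone with vertex at the origin: `t C ⊆ C` for each `t ≥ 0`. -/
def IsConeAtZero {V : Type*} [SMul ℝ V] (C : Set V) : Prop :=
  ∀ t : ℝ, 0 ≤ t → ∀ x ∈ C, t • x ∈ C

/-- A subequation (constraint set): a nonempty proper subset of the 2-jet space that satisfies
positivity (P), negativity (N) and the topological condition (T). -/
structure IsSubequation {n : ℕ} (F : Set (Jet n)) : Prop where
  nonempty : F.Nonempty
  ne_univ : F ≠ Set.univ
  positivity : ∀ (r : ℝ) (p : EuclideanSpace ℝ (Fin n)) (A P : SymMat n),
    (r, p, A) ∈ F → (P : Matrix (Fin n) (Fin n) ℝ).PosSemidef → (r, p, A + P) ∈ F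
  negativity : ∀ (r s : ℝ) (p : EuclideanSpace ℝ (Fin n)) (A : SymMat n),
    (r, p, A) ∈ F → s ≤ 0 → (r + s, p, A) ∈ F
  topological : F = closure (interior F)

/-- The Dirichlet dual `∼(-Int F)`. -/
def dirichletDual {n : ℕ} (F : Set (Jet n)) : Set (Jet n) :=
  {J | -J ∉ interior F}

/-- `F` is `M`-monotone: `F + M ⊆ F`. -/
def IsMonotoneFor {n : ℕ} (F M : Set (Jet n)) : Prop :=
  ∀ J ∈ F, ∀ K ∈ M, J + K ∈ F

/-- The minimal monotonicity set `𝓜₀ = 𝒩 × {0} × 𝒫`. -/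
def minimalMonotonicitySet (n : ℕ) : Set (Jet n) :=
  {J | J.1 ≤ 0 ∧ J.2.1 = 0 ∧ (J.2.2 : Matrix (Fin n) (Fin n) ℝ).PosSemidef}

/-- A monotonicity cone subequation: a closed convex cone with vertex at the origin that contains
`𝓜₀` and satisfies the topological condition (T). -/
structure IsMonotonicityConeSubequation {n : ℕ} (M : Set (Jet n)) : Prop where
  isClosed : IsClosed M
  convex : Convex ℝ M
  isCone : IsConeAtZero M
  minimal_subset : minimalMonotonicitySet n ⊆ M
  topological : M = closure (interior M)

/-- A directional cone: a closed convex cone in `ℝⁿ` (possibly all of `ℝⁿ`) with vertex at the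
origin and nonempty interior. -/
structure IsDirectionalCone {n : ℕ} (D : Set (EuclideanSpace ℝ (Fin n))) : Prop where
  isClosed : IsClosed D
  convex : Convex ℝ D
  isCone : IsConeAtZero D
  interior_nonempty : (interior D).Nonempty

/-- `𝓜(γ) = {(r, p, A) : r ≤ -γ |p|}`; for `γ = 0` this is `𝓜(𝒩)`. -/
def coneGamma (n : ℕ) (γ : ℝ) : Set (Jet n) :=
  {J | J.1 ≤ -γ * ‖J.2.1‖}

/-- `𝓜(𝒟) = ℝ × 𝒟 × Sym(n)`. -/
def coneDir {n : ℕ} (D : Set (EuclideanSpace ℝ (Fin n))) : Set (Jet n) :=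
  {J | J.2.1 ∈ D}

/-- `𝓜(R) = {(r, p, A) : A ≥ (|p| / R) I}` for finite `R`. -/
def coneR (n : ℕ) (R : ℝ) : Set (Jet n) :=
  {J | ((J.2.2 : Matrix (Fin n) (Fin n) ℝ) -
    (‖J.2.1‖ / R) • (1 : Matrix (Fin n) (Fin n) ℝ)).PosSemidef}

/-- `𝓜(𝒫) = ℝ × ℝⁿ × 𝒫`, which is also `𝓜(R)` for `R = +∞`. -/
def coneP (n : ℕ) : Set (Jet n) :=
  {J | (J.2.2 : Matrix (Fin n) (Fin n) ℝ).PosSemidef}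

/-- `𝓜(γ, 𝒟, R) = 𝓜(γ) ∩ 𝓜(𝒟) ∩ 𝓜(R)`. -/
def coneGDR {n : ℕ} (γ : ℝ) (D : Set (EuclideanSpace ℝ (Fin n))) (R : ℝ) : Set (Jet n) :=
  coneGamma n γ ∩ coneDir D ∩ coneR n R

/-- `𝓜(γ, 𝒟, 𝒫) = 𝓜(γ) ∩ 𝓜(𝒟) ∩ 𝓜(𝒫)`. -/
def coneGDP {n : ℕ} (γ : ℝ) (D : Set (EuclideanSpace ℝ (Fin n))) : Set (Jet n) :=
  coneGamma n γ ∩ coneDir D ∩ coneP n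

/-- The Hessian matrix `D²φ(x)` of second partial derivatives. -/
noncomputable def hessianMatrix {n : ℕ} (φ : EuclideanSpace ℝ (Fin n) → ℝ)
    (x : EuclideanSpace ℝ (Fin n)) : Matrix (Fin n) (Fin n) ℝ :=
  Matrix.of fun i j =>
    fderiv ℝ (fderiv ℝ φ) x (EuclideanSpace.single i 1) (EuclideanSpace.single j 1)

theorem hessianMatrix_mem {n : ℕ} {φ : EuclideanSpace ℝ (Fin n) → ℝ}
    {x : EuclideanSpace ℝ (Fin n)} (h : ContDiffAt ℝ 2 φ x) : hessianMatrix φ x ∈ SymMat n := by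
  have hs : IsSymmSndFDerivAt ℝ φ x := h.isSymmSndFDerivAt (by simp)
  exact Matrix.IsSymm.ext fun i j =>
    hs.eq (EuclideanSpace.single j 1) (EuclideanSpace.single i 1)

/-- The 2-jet `J²ₓφ = (φ(x), Dφ(x), D²φ(x))` of a function that is `C²` near `x`. -/
noncomputable def jetOf {n : ℕ} (φ : EuclideanSpace ℝ (Fin n) → ℝ)
    (x : EuclideanSpace ℝ (Fin n)) (h : ContDiffAt ℝ 2 φ x) : Jet n :=
  (φ x, gradient φ x, ⟨hessianMatrix φ x, hessianMatrix_mem h⟩)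

/-- `u` is `F`-subharmonic at `x₀` (viscosity sense): the 2-jet at `x₀` of every `C²` upper test
function for `u` at `x₀` lies in `F`. -/
def IsSubharmonicAt {n : ℕ} (F : Set (Jet n)) (u : EuclideanSpace ℝ (Fin n) → EReal)
    (x₀ : EuclideanSpace ℝ (Fin n)) : Prop :=
  ∀ (φ : EuclideanSpace ℝ (Fin n) → ℝ) (h : ContDiffAt ℝ 2 φ x₀),
    (∀ᶠ x in 𝓝 x₀, u x ≤ (φ x : EReal)) → u x₀ = (φ x₀ : EReal) → jetOf φ x₀ h ∈ F

/-- `u` is `F`-subharmonic on `X`. -/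
def IsSubharmonicOn {n : ℕ} (F : Set (Jet n)) (u : EuclideanSpace ℝ (Fin n) → EReal)
    (X : Set (EuclideanSpace ℝ (Fin n))) : Prop :=
  ∀ x ∈ X, IsSubharmonicAt F u x

/-- `u ∈ USC(S)`: upper semicontinuous on `S` with values in `[-∞, +∞)`. The values of `u`
outside `S` play no role. -/
def IsUSC {n : ℕ} (u : EuclideanSpace ℝ (Fin n) → EReal)
    (S : Set (EuclideanSpace ℝ (Fin n))) : Prop :=
  UpperSemicontinuousOn u S ∧ ∀ x ∈ S, u x ≠ ⊤

/-- The zero maximum principle (ZMP) for `G` on the closure of `Ω`. -/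
def ZeroMaximumPrinciple {n : ℕ} (G : Set (Jet n)) (Ω : Set (EuclideanSpace ℝ (Fin n))) : Prop :=
  ∀ z : EuclideanSpace ℝ (Fin n) → EReal, IsUSC z (closure Ω) → IsSubharmonicOn G z Ω →
    (∀ x ∈ frontier Ω, z x ≤ 0) → ∀ x ∈ Ω, z x ≤ 0

/-- The comparison principle (C) for `F` on the closure of `Ω`. -/
def ComparisonPrinciple {n : ℕ} (F : Set (Jet n)) (Ω : Set (EuclideanSpace ℝ (Fin n))) : Prop :=
  ∀ u v : EuclideanSpace ℝ (Fin n) → EReal, IsUSC u (closure Ω) → IsUSC v (closure Ω) →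
    IsSubharmonicOn F u Ω → IsSubharmonicOn (dirichletDual F) v Ω →
    (∀ x ∈ frontier Ω, u x + v x ≤ 0) → ∀ x ∈ Ω, u x + v x ≤ 0

/-- `Ω` is contained in a translate of the truncated cone `𝒟 ∩ B_R(0)`. -/
def InTranslateOfTruncatedCone {n : ℕ} (Ω D : Set (EuclideanSpace ℝ (Fin n))) (R : ℝ) : Prop :=
  ∃ y : EuclideanSpace ℝ (Fin n), Ω ⊆ (fun x => y + x) '' (D ∩ Metric.ball 0 R)

/-! Both principles rest on the function `x ↦ |x - y|²/2 - m`. When `x - y` lies in the interior of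
`𝒟` and has norm below `R`, positive multiples of its jet lie in the interior of `𝓜(γ, 𝒟, R)` once
`m` is large. For (ZMP), add a small multiple of it to a `z` that is positive somewhere. The maximum
is then interior, and the resulting test jet for `z` is minus an interior point of `M`, which the
dual forbids.

For comparison, the same paraboloid is added to `u + v`. To obtain jets of `u` and `v` separately,
replace them by sup-convolutions `U`, `V`, which are semiconvex, and maximize `U + V + α/2 |· -
q|²`. The jets found at a maximum `x` transfer to `u` at `Y x` and to `v` at `Y' x`. These points
may differ: the constraint sets do not depend on the point, so doubling of variables is not needed.
The jets satisfy `J₁ ∈ F` and `J₂` in the dual, while `-J₂ = J₁ + K` with `K` interior to `M`.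
Monotonicity puts `-J₂` in the interior of `F`, a contradiction.

The jets come from `exists_max_point_with_jets`, which takes the place of the theorems of Alexandrov
and Jensen. A semiconvex function bounded above has a least semiconcave majorant, which is
`C^{1,1}`. At a maximum point the majorants touch the functions, and the centre `q` is a Lipschitz
function of that point. As `q` fills a ball, the maximum points are not a null set, so Rademacher's
theorem supplies one at which both gradients are differentiable.

A general cone `M` contains some `𝓜(γ, 𝒟, R)`, because a suitable linear slice of `M` over the
gradient variable already has interior. -/

/-! ### Semiconvexity (`StrongConvexOn` with modulus `-K`) and `C^{1,1}` majorants. -/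

section SemiconvexRegularization

variable {E : Type*} [NormedAddCommGroup E] [InnerProductSpace ℝ E]

local notation "⟪" x ", " y "⟫" => inner ℝ x y

/-- A convex function on a finite-dimensional space has a subgradient at each point. -/
theorem ConvexOn.exists_subgradient [FiniteDimensional ℝ E] {f : E → ℝ}
    (hf : ConvexOn ℝ Set.univ f) (x : E) : ∃ p : E, ∀ z, f x + ⟪p, z - x⟫ ≤ f z := by
  have hc : Continuous f := hf.locallyLipschitz.continuous
  have hconv := hf.convex_strict_epigraph
  have hopen : IsOpen {p : E × ℝ | p.1 ∈ Set.univ ∧ f p.1 < p.2} := by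
    simpa using isOpen_lt (hc.comp continuous_fst) continuous_snd
  obtain ⟨L, hL⟩ := geometric_hahn_banach_open_point hconv hopen
    (x := (x, f x)) (by simp)
  have hsplit : ∀ z t, L (z, t) = L (z, 0) + t * L (0, 1) := by
    intro z t
    have : ((z, t) : E × ℝ) = (z, 0) + t • (0, 1) := by simp
    rw [this, map_add, map_smul, smul_eq_mul]
  have hneg : L (0, 1) < 0 := by
    have := hL (x, f x + 1) (by simp)
    rw [hsplit, hsplit x (f x)] at this
    linarith
  have hne : L (0, 1) ≠ 0 := hneg.ne
  have hle : ∀ z, L (z, f z) ≤ L (x, f x) := by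
    intro z
    refine le_of_forall_pos_le_add fun ε hε => ?_
    -- The separation concerns the strict epigraph only; this height above the graph changes `L` by
    -- exactly `-ε`.
    have := hL (z, f z + ε / (-L (0, 1))) (by
      simp only [Set.mem_univ, true_and, Set.mem_ofPred_eq]
      have : 0 < ε / (-L (0, 1)) := div_pos hε (by linarith)
      linarith)
    rw [hsplit] at this
    rw [hsplit z (f z)]
    have h2 : ε / (-L (0, 1)) * L (0, 1) = -ε := by
      field_simp
    nlinarith
  let ℓ : E →L[ℝ] ℝ := L.comp (ContinuousLinearMap.inl ℝ E ℝ)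
  have hℓ : ∀ z, ℓ z = L (z, 0) := fun z => by simp [ℓ]
  refine ⟨(-(L (0, 1))⁻¹) • (InnerProductSpace.toDual ℝ E).symm ℓ, fun z => ?_⟩
  rw [inner_smul_left, InnerProductSpace.toDual_symm_apply, map_sub, hℓ, hℓ]
  have h := hle z
  rw [hsplit z (f z), hsplit x (f x)] at h
  have h3 : (-(L (0, 1))⁻¹) * (L (z, 0) - L (x, 0)) ≤ f z - f x := by
    rw [← sub_nonneg]
    have : f z - f x - (-(L (0, 1))⁻¹) * (L (z, 0) - L (x, 0)) =
        (-(L (0, 1)))⁻¹ * (L (x, 0) + f x * L (0, 1) - (L (z, 0) + f z * L (0, 1))) := by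
      field_simp
      ring
    rw [this]
    exact mul_nonneg (inv_nonneg.2 (by linarith)) (by linarith)
  simp only [conj_trivial]
  linarith

/-- A function that is both `K`-semiconvex and `K`-semiconcave is `C¹`, with quadratic error in its
first-order expansion. -/
theorem exists_gradient_of_semiconvex_semiconcave [FiniteDimensional ℝ E] {K : ℝ} {g : E → ℝ}
    (h₁ : StrongConvexOn Set.univ (-K) g) (h₂ : StrongConvexOn Set.univ (-K) (-g)) :
    ∃ G : E → E, ∀ x z, |g z - g x - ⟪G x, z - x⟫| ≤ K / 2 * ‖z - x‖ ^ 2 := by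
  have key : ∀ f : E → ℝ, StrongConvexOn Set.univ (-K) f → ∀ x, ∃ p : E, ∀ z,
      f x + ⟪p, z - x⟫ - K / 2 * ‖z - x‖ ^ 2 ≤ f z := by
    intro f hf x
    obtain ⟨p, hp⟩ := (strongConvexOn_iff_convex.1 hf).exists_subgradient x
    refine ⟨p - K • x, fun z => ?_⟩
    have h := hp z
    have e : ‖z - x‖ ^ 2 = ‖z‖ ^ 2 - 2 * ⟪x, z⟫ + ‖x‖ ^ 2 := by
      rw [norm_sub_sq_real, real_inner_comm]
    have e2 : ⟪p - K • x, z - x⟫ = ⟪p, z - x⟫ - K * (⟪x, z⟫ - ‖x‖ ^ 2) := by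
      rw [inner_sub_left, inner_smul_left, inner_sub_right x, real_inner_self_eq_norm_sq]
      simp
    rw [e2, e]
    linarith
  choose G hG using key g h₁
  choose H hH using key (-g) h₂
  have hadd : ∀ x, H x = -G x := by
    intro x
    by_contra hne
    set d : E := G x + H x with hd
    have hd0 : 0 < ‖d‖ ^ 2 := by
      have : d ≠ 0 := fun h0 => hne (by rw [eq_neg_iff_add_eq_zero, add_comm]; exact h0)
      positivity
    -- Adding the lower bounds for `g` and `-g` along `d` leaves a linear term bounded by a
    -- quadratic one; small `s > 0` then contradicts `d ≠ 0`.
    have hineq : ∀ s : ℝ, s * ‖d‖ ^ 2 ≤ K * (s ^ 2 * ‖d‖ ^ 2) := by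
      intro s
      have a1 := hG x (x + s • d)
      have a2 := hH x (x + s • d)
      simp only [add_sub_cancel_left, Pi.neg_apply, norm_smul, inner_smul_right, mul_pow,
        Real.norm_eq_abs, sq_abs] at a1 a2
      have : s * ‖d‖ ^ 2 = s * ⟪G x, d⟫ + s * ⟪H x, d⟫ := by
        rw [← mul_add, ← inner_add_left, ← hd, real_inner_self_eq_norm_sq]
      rw [this]
      linarith
    have h3 := hineq (1 / (2 * (|K| + 1)))
    have hK : 0 < |K| + 1 := by positivity
    have h4 : 1 / (2 * (|K| + 1)) ≤ K * (1 / (2 * (|K| + 1))) ^ 2 := by nlinarith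
    have hs : 0 < 1 / (2 * (|K| + 1)) := by positivity
    have h5 : K * (1 / (2 * (|K| + 1))) < 1 := by
      rw [mul_one_div, div_lt_one (by positivity)]
      linarith [le_abs_self K, abs_nonneg K]
    nlinarith
  refine ⟨G, fun x z => abs_le.2 ⟨?_, ?_⟩⟩
  · linarith [hG x z]
  · have := hH x z
    rw [hadd, inner_neg_left] at this
    simp only [Pi.neg_apply] at this
    linarith

theorem hasFDerivAt_of_abs_sub_le {K : ℝ} {g : E → ℝ} {p x : E}
    (h : ∀ z, |g z - g x - ⟪p, z - x⟫| ≤ K * ‖z - x‖ ^ 2) :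
    HasFDerivAt g (innerSL ℝ p) x := by
  rw [hasFDerivAt_iff_isLittleO]
  have h1 : (fun z => g z - g x - innerSL ℝ p (z - x)) =O[𝓝 x] fun z => ‖z - x‖ ^ 2 := by
    refine Asymptotics.IsBigO.of_bound K (Filter.Eventually.of_forall fun z => ?_)
    simpa using h z
  refine h1.trans_isLittleO ?_
  have h2 : (fun z : E => ‖z - x‖ ^ 2) =o[𝓝 x] fun z => z - x := by
    have := (Asymptotics.isLittleO_norm_pow_id (E' := E) one_lt_two).comp_tendsto
      (show Filter.Tendsto (fun z => z - x) (𝓝 x) (𝓝 0) by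
        have : Filter.Tendsto (fun z => z - x) (𝓝 x) (𝓝 (x - x)) :=
          (continuous_id.sub continuous_const).tendsto x
        simpa using this)
    exact this
  exact h2

/-- Compare the expansions from `x` and from `y` at a third point `y + w`, with `w` parallel to `G x
- G y` and of length `‖x - y‖`. The three errors add up to `K/2 · (1 + 4 + 1) = 3K` times `‖x -
y‖²`. -/
theorem lipschitzWith_of_abs_sub_le {K : ℝ} (hK : 0 ≤ K) {g : E → ℝ} {G : E → E}
    (h : ∀ x z, |g z - g x - ⟪G x, z - x⟫| ≤ K / 2 * ‖z - x‖ ^ 2) :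
    LipschitzWith (Real.toNNReal (3 * K)) G := by
  refine LipschitzWith.of_dist_le_mul fun x y => ?_
  rw [Real.coe_toNNReal _ (by positivity), dist_eq_norm, dist_eq_norm]
  by_cases hG : G x - G y = 0
  · rw [hG, norm_zero]; positivity
  have hpos : 0 < ‖G x - G y‖ := norm_pos_iff.2 hG
  set w := (‖x - y‖ / ‖G x - G y‖) • (G x - G y) with hw
  have hwn : ‖w‖ = ‖x - y‖ := by
    rw [hw, norm_smul, norm_div, norm_norm, norm_norm]; field_simp
  have a1 := (abs_le.1 (h y (y + w))).2
  have a2 := (abs_le.1 (h x (y + w))).1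
  have a3 := (abs_le.1 (h x y)).2
  have e1 : ⟪G x, y + w - x⟫ = ⟪G x, y - x⟫ + ⟪G x, w⟫ := by
    rw [← inner_add_right]; congr 1; abel
  have n1 : ‖y - x‖ = ‖x - y‖ := norm_sub_rev _ _
  have n2 : ‖y + w - x‖ ≤ 2 * ‖x - y‖ := by
    calc ‖y + w - x‖ = ‖(y - x) + w‖ := by congr 1; abel
      _ ≤ ‖y - x‖ + ‖w‖ := norm_add_le _ _
      _ = 2 * ‖x - y‖ := by rw [n1, hwn]; ring
  have n3 : ‖y + w - x‖ ^ 2 ≤ 4 * ‖x - y‖ ^ 2 := by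
    nlinarith [norm_nonneg (y + w - x), norm_nonneg (x - y)]
  rw [add_sub_cancel_left, hwn] at a1
  rw [n1] at a3
  rw [e1] at a2
  have h4 : ⟪G x, w⟫ - ⟪G y, w⟫ ≤ 3 * K * ‖x - y‖ ^ 2 := by nlinarith
  have h5 : ⟪G x, w⟫ - ⟪G y, w⟫ = ‖x - y‖ * ‖G x - G y‖ := by
    rw [← inner_sub_left, hw, inner_smul_right, real_inner_self_eq_norm_sq]
    field_simp
  rw [h5] at h4
  rcases (norm_nonneg (x - y)).eq_or_lt with h0 | h0
  · have : x = y := by rwa [eq_comm, norm_eq_zero, sub_eq_zero] at h0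
    exact absurd (by rw [this, sub_self]) hG
  · refine le_of_mul_le_mul_left ?_ h0
    nlinarith

/-- The pointwise infimum of a family of `K`-semiconcave functions bounded below. -/
theorem strongConvexOn_neg_iInf {ι : Type*} [Nonempty ι] {K : ℝ} {k : ι → E → ℝ}
    (hk : ∀ i, StrongConvexOn Set.univ (-K) (-k i))
    (hbdd : ∀ x, BddBelow (Set.range fun i => k i x)) :
    StrongConvexOn Set.univ (-K) (-fun x => ⨅ i, k i x) := by
  refine ⟨convex_univ, fun x _ y _ a b ha hb hab => ?_⟩
  simp only [Pi.neg_apply, smul_eq_mul]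
  rw [neg_le]
  refine le_ciInf fun i => ?_
  have h := (hk i).2 (Set.mem_univ x) (Set.mem_univ y) ha hb hab
  simp only [Pi.neg_apply, smul_eq_mul] at h
  have h1 := mul_le_mul_of_nonneg_left (ciInf_le (hbdd x) i) ha
  have h2 := mul_le_mul_of_nonneg_left (ciInf_le (hbdd y) i) hb
  linarith

/-- A `K`-semiconvex function bounded above has a least `K`-semiconcave majorant, and this
majorant is again `K`-semiconvex. -/
theorem StrongConvexOn.exists_least_semiconcave_majorant {K C : ℝ} (hK : 0 ≤ K) {f : E → ℝ}
    (hf : StrongConvexOn Set.univ (-K) f) (hC : ∀ x, f x ≤ C) :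
    ∃ g : E → ℝ, (∀ x, f x ≤ g x) ∧ StrongConvexOn Set.univ (-K) g ∧
      StrongConvexOn Set.univ (-K) (-g) ∧
      ∀ k : E → ℝ, StrongConvexOn Set.univ (-K) (-k) → (∀ x, f x ≤ k x) → ∀ x, g x ≤ k x := by
  let ι := {k : E → ℝ // StrongConvexOn Set.univ (-K) (-k) ∧ ∀ x, f x ≤ k x}
  have : Nonempty ι := by
    refine ⟨⟨fun _ => C, ?_, hC⟩⟩
    refine ⟨convex_univ, fun x _ y _ a b ha hb hab => ?_⟩
    have : 0 ≤ a * b * (K / 2 * ‖x - y‖ ^ 2) := by positivity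
    have h2 : a * C + b * C = C := by rw [← add_mul, hab, one_mul]
    simp only [Pi.neg_apply, smul_eq_mul]
    linarith
  have hbdd : ∀ x, BddBelow (Set.range fun i : ι => i.1 x) := fun x =>
    ⟨f x, by rintro _ ⟨i, rfl⟩; exact i.2.2 x⟩
  have hmin : ∀ k : E → ℝ, StrongConvexOn Set.univ (-K) (-k) → (∀ x, f x ≤ k x) →
      ∀ x, (⨅ i : ι, i.1 x) ≤ k x := fun k h1 h2 x => ciInf_le (hbdd x) (⟨k, h1, h2⟩ : ι)
  have hcc := strongConvexOn_neg_iInf (fun i : ι => i.2.1) hbdd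
  have hle : ∀ x, f x ≤ ⨅ i : ι, i.1 x := fun x => le_ciInf fun i => i.2.2 x
  refine ⟨fun x => ⨅ i : ι, i.1 x, hle, ?_, hcc, hmin⟩
  set g : E → ℝ := fun x => ⨅ i : ι, i.1 x with hg
  refine ⟨convex_univ, fun x _ y _ a b ha hb hab => ?_⟩
  have hxa : ∀ z : E, a • (z + b • (x - y)) + b • (z - a • (x - y)) = z := by
    intro z
    have : a • (z + b • (x - y)) + b • (z - a • (x - y)) = (a + b) • z := by module
    rw [this, hab, one_smul]
  -- This average of translates of `g` is again `K`-semiconcave, and it majorizes `f` because `f` is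
  -- `K`-semiconvex. Minimality of `g`, read at `a • x + b • y`, is the semiconvexity inequality for
  -- `g`.
  have h := hmin (fun z => a * g (z + b • (x - y)) + b * g (z - a • (x - y)) +
      a * b * (K / 2 * ‖x - y‖ ^ 2)) ?_ ?_ (a • x + b • y)
  · have e1 : a • x + b • y + b • (x - y) = x := by
      have : a • x + b • y + b • (x - y) = (a + b) • x := by module
      rw [this, hab, one_smul]
    have e2 : a • x + b • y - a • (x - y) = y := by
      have : a • x + b • y - a • (x - y) = (a + b) • y := by module
      rw [this, hab, one_smul]
    simp only [e1, e2] at h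
    simp only [smul_eq_mul]
    linarith
  · refine ⟨convex_univ, fun z _ w _ c d hc hd hcd => ?_⟩
    have h1 := hcc.2 (Set.mem_univ (z + b • (x - y))) (Set.mem_univ (w + b • (x - y))) hc hd hcd
    have h2 := hcc.2 (Set.mem_univ (z - a • (x - y))) (Set.mem_univ (w - a • (x - y))) hc hd hcd
    have e1 : c • (z + b • (x - y)) + d • (w + b • (x - y)) = c • z + d • w + b • (x - y) := by
      have : c • (z + b • (x - y)) + d • (w + b • (x - y)) =
        c • z + d • w + (c + d) • b • (x - y) := by module
      rw [this, hcd, one_smul]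
    have e2 : c • (z - a • (x - y)) + d • (w - a • (x - y)) = c • z + d • w - a • (x - y) := by
      have : c • (z - a • (x - y)) + d • (w - a • (x - y)) =
        c • z + d • w - (c + d) • a • (x - y) := by module
      rw [this, hcd, one_smul]
    rw [e1, add_sub_add_right_eq_sub] at h1
    rw [e2, sub_sub_sub_cancel_right] at h2
    simp only [Pi.neg_apply, smul_eq_mul] at h1 h2 ⊢
    have h1' := mul_le_mul_of_nonneg_left h1 ha
    have h2' := mul_le_mul_of_nonneg_left h2 hb
    set T := c * d * (-K / 2 * ‖z - w‖ ^ 2)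
    set S := a * b * (K / 2 * ‖x - y‖ ^ 2)
    have hS : c * S + d * S = S := by rw [← add_mul, hcd, one_mul]
    have hT : a * T + b * T = T := by rw [← add_mul, hab, one_mul]
    linarith
  · intro z
    have h1 := hf.2 (Set.mem_univ (z + b • (x - y))) (Set.mem_univ (z - a • (x - y))) ha hb hab
    have e : z + b • (x - y) - (z - a • (x - y)) = x - y := by
      have : z + b • (x - y) - (z - a • (x - y)) = (a + b) • (x - y) := by module
      rw [this, hab, one_smul]
    rw [hxa, e] at h1
    simp only [smul_eq_mul] at h1
    have h2 := mul_le_mul_of_nonneg_left (hle (z + b • (x - y))) ha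
    have h3 := mul_le_mul_of_nonneg_left (hle (z - a • (x - y))) hb
    simp only [hg]
    linarith

end SemiconvexRegularization

/-! ### Second-order expansions and jets at maximum points. -/

section SecondOrder

variable {E : Type*} [NormedAddCommGroup E] [InnerProductSpace ℝ E]

local notation "⟪" x ", " y "⟫" => inner ℝ x y

/-- The derivative of a gradient is symmetric. -/
theorem inner_symm_of_hasGradientAt [CompleteSpace E] {g : E → ℝ} {G : E → E} {T : E →L[ℝ] E}
    {x : E} (hg : ∀ z, HasGradientAt g (G z) z) (hG : HasFDerivAt G T x) (v w : E) :
    ⟪T v, w⟫ = ⟪v, T w⟫ := by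
  let B : E →L[ℝ] E →L[ℝ] ℝ := (isBoundedBilinearMap_inner (𝕜 := ℝ) (E := E)).toContinuousLinearMap
  have hB : ∀ a b, B a b = ⟪a, b⟫ := fun _ _ => rfl
  have h1 : ∀ z, HasFDerivAt g (B (G z)) z := by
    intro z
    refine (hg z).hasFDerivAt.congr_fderiv ?_
    ext w
    simp [hB]
  have h2 : HasFDerivAt (fun z => B (G z)) (B.comp T) x := B.hasFDerivAt.comp x hG
  have := second_derivative_symmetric h1 h2 v w
  simp only [ContinuousLinearMap.comp_apply, hB] at this
  rw [this, real_inner_comm]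

theorem hasGradientAt_quadratic [CompleteSpace E] {T : E →L[ℝ] E}
    (hT : ∀ v w, ⟪T v, w⟫ = ⟪v, T w⟫) (a : ℝ) (p x z : E) :
    HasGradientAt (fun z => a + ⟪p, z - x⟫ + 1 / 2 * ⟪z - x, T (z - x)⟫) (p + T (z - x)) z := by
  rw [hasGradientAt_iff_hasFDerivAt]
  have hid : HasFDerivAt (fun z => z - x) (ContinuousLinearMap.id ℝ E) z :=
    (hasFDerivAt_id z).sub_const x
  have h1 := ((hasFDerivAt_const p z).inner ℝ hid).const_add a
  have h2 := (hid.inner ℝ (T.hasFDerivAt.comp z hid)).const_mul (1 / 2 : ℝ)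
  refine (h1.add h2).congr_fderiv ?_
  ext w
  have h3 : ⟪w, T z - T x⟫ = ⟪T (z - x), w⟫ := by rw [real_inner_comm, map_sub]
  simp only [map_sub] at h3
  simp [fderivInnerCLM_apply, ← hT, h3, inner_sub_left]
  ring

/-- Second-order Taylor expansion at a point where the gradient is differentiable. -/
theorem eventually_abs_sub_taylor_le [CompleteSpace E] {g : E → ℝ} {G : E → E} {T : E →L[ℝ] E}
    {x : E} (hg : ∀ z, HasGradientAt g (G z) z) (hG : HasFDerivAt G T x) {δ : ℝ} (hδ : 0 < δ) :
    ∀ᶠ z in 𝓝 x, |g z - (g x + ⟪G x, z - x⟫ + 1 / 2 * ⟪z - x, T (z - x)⟫)| ≤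
      δ * ‖z - x‖ ^ 2 := by
  have hT := inner_symm_of_hasGradientAt hg hG
  have ho := (hasFDerivAt_iff_isLittleO.1 hG).def hδ
  obtain ⟨r, hr, hball⟩ := Metric.eventually_nhds_iff_ball.1 ho
  filter_upwards [Metric.ball_mem_nhds x hr] with z hz
  have hz' : ‖z - x‖ < r := by simpa [dist_eq_norm] using hz
  -- Mean value inequality for `g` minus its quadratic expansion: the gradient of the difference is
  -- `G y - G x - T (y - x)`, small by differentiability of `G` at `x`.
  have hder : ∀ y ∈ Metric.closedBall x ‖z - x‖, HasFDerivWithinAt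
      (fun y => g y - (g x + ⟪G x, y - x⟫ + 1 / 2 * ⟪y - x, T (y - x)⟫))
      (InnerProductSpace.toDual ℝ E (G y) - InnerProductSpace.toDual ℝ E (G x + T (y - x)))
      (Metric.closedBall x ‖z - x‖) y := fun y _ =>
    ((hg y).hasFDerivAt.sub (hasGradientAt_quadratic hT (g x) (G x) x y).hasFDerivAt).hasFDerivWithinAt
  have hbd : ∀ y ∈ Metric.closedBall x ‖z - x‖,
      ‖InnerProductSpace.toDual ℝ E (G y) - InnerProductSpace.toDual ℝ E (G x + T (y - x))‖ ≤
        δ * ‖z - x‖ := by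
    intro y hy
    have hy' : ‖y - x‖ ≤ ‖z - x‖ := by simpa [dist_eq_norm] using hy
    rw [← map_sub, LinearIsometryEquiv.norm_map, ← sub_sub]
    refine (hball y ?_).trans (mul_le_mul_of_nonneg_left hy' hδ.le)
    rw [Metric.mem_ball, dist_eq_norm]; linarith
  have := (convex_closedBall x ‖z - x‖).norm_image_sub_le_of_norm_hasFDerivWithin_le hder hbd
    (Metric.mem_closedBall_self (norm_nonneg _)) (show z ∈ Metric.closedBall x ‖z - x‖ by
      simp [dist_eq_norm])
  simp only [sub_self, inner_zero_right, map_zero, mul_zero, add_zero, sub_zero,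
    Real.norm_eq_abs] at this
  linarith

/-- First- and second-order conditions at a maximum of `g₁ + g₂ + α/2 |· - q|²`. -/
theorem gradient_hessian_of_isMax [CompleteSpace E] {g₁ g₂ : E → ℝ} {G₁ G₂ : E → E}
    {T₁ T₂ : E →L[ℝ] E} {x q : E} {α : ℝ}
    (hg₁ : ∀ z, HasGradientAt g₁ (G₁ z) z) (hg₂ : ∀ z, HasGradientAt g₂ (G₂ z) z)
    (hmax : ∀ z, g₁ z + g₂ z + α / 2 * ‖z - q‖ ^ 2 ≤ g₁ x + g₂ x + α / 2 * ‖x - q‖ ^ 2) :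
    G₁ x + G₂ x = -α • (x - q) ∧ (HasFDerivAt G₁ T₁ x → HasFDerivAt G₂ T₂ x →
      ∀ h, ⟪h, T₁ h⟫ + ⟪h, T₂ h⟫ + α * ‖h‖ ^ 2 ≤ 0) := by
  have hgrad : G₁ x + G₂ x = -α • (x - q) := by
    have hid : HasFDerivAt (fun z => z - q) (ContinuousLinearMap.id ℝ E) x :=
      (hasFDerivAt_id x).sub_const q
    have h3 := ((hid.norm_sq).const_mul (α / 2))
    have hd := ((hg₁ x).hasFDerivAt.add (hg₂ x).hasFDerivAt).add h3
    have h0 := IsLocalMax.hasFDerivAt_eq_zero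
      (Filter.Eventually.of_forall fun z => by simpa using hmax z) hd
    have : G₁ x + G₂ x + α • (x - q) = 0 := by
      refine ext_inner_right ℝ fun w => ?_
      have h4 := congrArg (fun L => L w) h0
      simp at h4
      rw [inner_add_left, inner_add_left, inner_smul_left, inner_zero_left, inner_sub_left]
      simp
      linarith
    rw [neg_smul, ← eq_neg_iff_add_eq_zero.2 this]
  refine ⟨hgrad, fun hG₁ hG₂ h => ?_⟩
  -- Along `x + t • h` the first-order terms cancel by `hgrad`. The two Taylor errors `δ t² ‖h‖²`,
  -- doubled to clear the factors `1/2`, give the `4`.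
  have key : ∀ δ : ℝ, 0 < δ →
      ⟪h, T₁ h⟫ + ⟪h, T₂ h⟫ + α * ‖h‖ ^ 2 ≤ 4 * ‖h‖ ^ 2 * δ := by
    intro δ hδ
    have hev := (eventually_abs_sub_taylor_le hg₁ hG₁ hδ).and
      (eventually_abs_sub_taylor_le hg₂ hG₂ hδ)
    have hlim : Filter.Tendsto (fun t : ℝ => x + t • h) (𝓝[>] 0) (𝓝 x) := by
      have : Filter.Tendsto (fun t : ℝ => x + t • h) (𝓝 0) (𝓝 (x + (0 : ℝ) • h)) :=
        (by fun_prop : Continuous fun t : ℝ => x + t • h).tendsto 0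
      rw [zero_smul, add_zero] at this
      exact this.mono_left nhdsWithin_le_nhds
    obtain ⟨t, ⟨ht1, ht2⟩, ht⟩ := ((hlim.eventually hev).and self_mem_nhdsWithin).exists
    have ht0 : 0 < t := ht
    have hm := hmax (x + t • h)
    have e : x + t • h - q = (x - q) + t • h := by abel
    rw [e, norm_add_sq_real, inner_smul_right, norm_smul, mul_pow, Real.norm_eq_abs, sq_abs] at hm
    simp only [add_sub_cancel_left, map_smul, inner_smul_left, inner_smul_right, norm_smul, mul_pow,
      Real.norm_eq_abs, sq_abs, conj_trivial] at ht1 ht2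
    have h1 := (abs_le.1 ht1).1
    have h2 := (abs_le.1 ht2).1
    have h3 : ⟪G₁ x, h⟫ + ⟪G₂ x, h⟫ = -(α * ⟪x - q, h⟫) := by
      rw [← inner_add_left, hgrad, inner_smul_left]; simp
    have h4 : t * ⟪G₁ x, h⟫ + t * ⟪G₂ x, h⟫ = -(t * (α * ⟪x - q, h⟫)) := by
      rw [← mul_add, h3]; ring
    have h5 : t ^ 2 * (⟪h, T₁ h⟫ + ⟪h, T₂ h⟫ + α * ‖h‖ ^ 2) ≤ t ^ 2 * (4 * ‖h‖ ^ 2 * δ) := by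
      nlinarith
    exact le_of_mul_le_mul_left h5 (by positivity)
  by_contra! hpos
  rcases (norm_nonneg h).eq_or_lt with h0 | h0
  · have := key 1 one_pos
    rw [← h0] at this hpos
    linarith
  · have h1 := key ((⟪h, T₁ h⟫ + ⟪h, T₂ h⟫ + α * ‖h‖ ^ 2) / (8 * ‖h‖ ^ 2)) (by positivity)
    have h2 : 4 * ‖h‖ ^ 2 * ((⟪h, T₁ h⟫ + ⟪h, T₂ h⟫ + α * ‖h‖ ^ 2) / (8 * ‖h‖ ^ 2)) =
        (⟪h, T₁ h⟫ + ⟪h, T₂ h⟫ + α * ‖h‖ ^ 2) / 2 := by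
      field_simp; ring
    linarith

open MeasureTheory in
/-- If a Lipschitz map of a finite-dimensional space sends `S` onto a superset of a ball, then a
property that holds almost everywhere holds at some point of `S`. -/
theorem LipschitzWith.exists_mem_of_ball_subset_image [FiniteDimensional ℝ E]
    [MeasurableSpace E] [BorelSpace E] {C : NNReal} {Φ : E → E} (hΦ : LipschitzWith C Φ)
    {S : Set E} {q : E} {ρ : ℝ} (hρ : 0 < ρ) (hS : Metric.ball q ρ ⊆ Φ '' S) {P : E → Prop}
    (hP : ∀ᵐ x ∂(Measure.hausdorffMeasure (Module.finrank ℝ E) : Measure E), P x) :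
    ∃ x ∈ S, P x := by
  by_contra! hcon
  have hnull : (Measure.hausdorffMeasure (Module.finrank ℝ E) : Measure E) S = 0 :=
    measure_mono_null (fun x hx => hcon x hx) (ae_iff.1 hP)
  have h1 := hΦ.hausdorffMeasure_image_le (d := Module.finrank ℝ E) (by positivity) S
  rw [hnull, mul_zero, nonpos_iff_eq_zero] at h1
  have h2 := measure_mono_null hS h1
  exact (Metric.measure_ball_pos _ q hρ).ne' h2

/-- A form of the theorem on sums for semiconvex functions: if `f₁ + f₂ + α/2 |· - q|²` attains its
maximum for all `q` in a ball, then for some such `q` there are second-order upper test jets for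
`f₁` and `f₂` at a maximum point that satisfy the first- and second-order conditions. -/
theorem exists_max_point_with_jets [FiniteDimensional ℝ E] {f₁ f₂ : E → ℝ} {K C₁ C₂ α ρ : ℝ}
    (hK : 0 ≤ K) (hf₁ : StrongConvexOn Set.univ (-K) f₁) (hf₂ : StrongConvexOn Set.univ (-K) f₂)
    (hC₁ : ∀ x, f₁ x ≤ C₁) (hC₂ : ∀ x, f₂ x ≤ C₂) (hα : 0 < α) (hρ : 0 < ρ) (q₀ : E)
    (hmax : ∀ q ∈ Metric.ball q₀ ρ, ∃ x, ∀ z, f₁ z + f₂ z + α / 2 * ‖z - q‖ ^ 2 ≤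
      f₁ x + f₂ x + α / 2 * ‖x - q‖ ^ 2) :
    ∃ q ∈ Metric.ball q₀ ρ, ∃ (x p₁ p₂ : E) (T₁ T₂ : E →L[ℝ] E),
      (∀ z, f₁ z + f₂ z + α / 2 * ‖z - q‖ ^ 2 ≤ f₁ x + f₂ x + α / 2 * ‖x - q‖ ^ 2) ∧
      p₁ + p₂ = -α • (x - q) ∧ (∀ h, ⟪h, T₁ h⟫ + ⟪h, T₂ h⟫ + α * ‖h‖ ^ 2 ≤ 0) ∧
      (∀ v w, ⟪T₁ v, w⟫ = ⟪v, T₁ w⟫) ∧ (∀ v w, ⟪T₂ v, w⟫ = ⟪v, T₂ w⟫) ∧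
      (∀ δ > 0, ∀ᶠ z in 𝓝 x,
        f₁ z ≤ f₁ x + ⟪p₁, z - x⟫ + 1 / 2 * ⟪z - x, T₁ (z - x)⟫ + δ * ‖z - x‖ ^ 2) ∧
      (∀ δ > 0, ∀ᶠ z in 𝓝 x,
        f₂ z ≤ f₂ x + ⟪p₂, z - x⟫ + 1 / 2 * ⟪z - x, T₂ (z - x)⟫ + δ * ‖z - x‖ ^ 2) := by
  obtain ⟨g₁, hfg₁, hg₁x, hg₁c, hmin₁⟩ := hf₁.exists_least_semiconcave_majorant hK hC₁
  obtain ⟨g₂, hfg₂, hg₂x, hg₂c, hmin₂⟩ := hf₂.exists_least_semiconcave_majorant hK hC₂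
  obtain ⟨G₁, hG₁⟩ := exists_gradient_of_semiconvex_semiconcave hg₁x hg₁c
  obtain ⟨G₂, hG₂⟩ := exists_gradient_of_semiconvex_semiconcave hg₂x hg₂c
  have hgr₁ : ∀ z, HasGradientAt g₁ (G₁ z) z := fun z => by
    rw [hasGradientAt_iff_hasFDerivAt]; exact hasFDerivAt_of_abs_sub_le (hG₁ z)
  have hgr₂ : ∀ z, HasGradientAt g₂ (G₂ z) z := fun z => by
    rw [hasGradientAt_iff_hasFDerivAt]; exact hasFDerivAt_of_abs_sub_le (hG₂ z)
  have hL₁ := lipschitzWith_of_abs_sub_le hK hG₁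
  have hL₂ := lipschitzWith_of_abs_sub_le hK hG₂
  -- the majorants obey the same upper bound by a concave paraboloid
  have hsc : ∀ (f : E → ℝ) (q : E) (c : ℝ), StrongConvexOn Set.univ (-K) f →
      StrongConvexOn Set.univ (-K) (-fun z => c - α / 2 * ‖z - q‖ ^ 2 - f z) := by
    intro f q c hf
    refine ⟨convex_univ, fun x _ y _ a b ha hb hab => ?_⟩
    have h1 := hf.2 (Set.mem_univ x) (Set.mem_univ y) ha hb hab
    have h2 : ‖a • x + b • y - q‖ ^ 2 ≤ a * ‖x - q‖ ^ 2 + b * ‖y - q‖ ^ 2 := by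
      have e : a • x + b • y - q = a • (x - q) + b • (y - q) := by
        have : a • (x - q) + b • (y - q) = a • x + b • y - (a + b) • q := by module
        rw [this, hab, one_smul]
      rw [e]
      have := ((convexOn_norm (convex_univ (𝕜 := ℝ) (E := E))).pow (fun _ _ => norm_nonneg _) 2).2
        (Set.mem_univ (x - q)) (Set.mem_univ (y - q)) ha hb hab
      simpa using this
    have h3 := mul_le_mul_of_nonneg_left h2 (half_pos hα).le
    have h4 : a * c + b * c = c := by rw [← add_mul, hab, one_mul]
    simp only [Pi.neg_apply, smul_eq_mul] at h1 ⊢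
    linarith
  have hgle : ∀ (q : E) (c : ℝ), (∀ z, f₁ z + f₂ z + α / 2 * ‖z - q‖ ^ 2 ≤ c) →
      ∀ z, g₁ z + g₂ z + α / 2 * ‖z - q‖ ^ 2 ≤ c := by
    intro q c h
    -- The function `c - α/2 |· - q|² - f₂` is a `K`-semiconcave majorant of `f₁`, hence lies above
    -- `g₁`. The same argument then replaces `f₂` by `g₂`.
    have h1 := hmin₁ _ (hsc f₂ q c hf₂) fun z => by linarith [h z]
    have h2 := hmin₂ _ (hsc g₁ q c hg₁x) fun z => by linarith [h1 z]
    intro z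
    linarith [h2 z]
  have hcontact : ∀ q x, (∀ z, f₁ z + f₂ z + α / 2 * ‖z - q‖ ^ 2 ≤
      f₁ x + f₂ x + α / 2 * ‖x - q‖ ^ 2) → g₁ x = f₁ x ∧ g₂ x = f₂ x ∧
      ∀ z, g₁ z + g₂ z + α / 2 * ‖z - q‖ ^ 2 ≤ g₁ x + g₂ x + α / 2 * ‖x - q‖ ^ 2 := by
    intro q x h
    have h1 := hgle q _ h
    have h2 := h1 x
    have h3 := hfg₁ x
    have h4 := hfg₂ x
    have e1 : g₁ x = f₁ x := by linarith
    have e2 : g₂ x = f₂ x := by linarith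
    exact ⟨e1, e2, by rw [e1, e2]; exact h1⟩
  borelize E
  set S : Set E := {x | ∃ q ∈ Metric.ball q₀ ρ, ∀ z, f₁ z + f₂ z + α / 2 * ‖z - q‖ ^ 2 ≤
      f₁ x + f₂ x + α / 2 * ‖x - q‖ ^ 2} with hS
  -- Solving the first-order condition for the centre gives `q = x + α⁻¹ (G₁ x + G₂ x)`, which is
  -- Lipschitz in `x`.
  have hΦ := LipschitzWith.id.add ((lipschitzWith_smul (α⁻¹ : ℝ)).comp (hL₁.add hL₂))
  have hball : Metric.ball q₀ ρ ⊆
      (fun x => id x + (fun y : E => α⁻¹ • y) (G₁ x + G₂ x)) '' S := by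
    intro q hq
    obtain ⟨x, hx⟩ := hmax q hq
    refine ⟨x, ⟨q, hq, hx⟩, ?_⟩
    have h1 := (gradient_hessian_of_isMax (T₁ := 0) (T₂ := 0) hgr₁ hgr₂ (hcontact q x hx).2.2).1
    simp only [id, h1, smul_smul]
    rw [mul_neg, inv_mul_cancel₀ hα.ne']
    module
  obtain ⟨x, ⟨q, hq, hx⟩, hd₁, hd₂⟩ := hΦ.exists_mem_of_ball_subset_image hρ hball
    (hL₁.ae_differentiableAt.and hL₂.ae_differentiableAt)
  obtain ⟨T₁, hT₁⟩ := hd₁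
  obtain ⟨T₂, hT₂⟩ := hd₂
  obtain ⟨e₁, e₂, hgx⟩ := hcontact q x hx
  obtain ⟨h1, h2⟩ := gradient_hessian_of_isMax hgr₁ hgr₂ hgx
  refine ⟨q, hq, x, G₁ x, G₂ x, T₁, T₂, hx, h1, h2 hT₁ hT₂,
    inner_symm_of_hasGradientAt hgr₁ hT₁, inner_symm_of_hasGradientAt hgr₂ hT₂, ?_, ?_⟩
  · intro δ hδ
    filter_upwards [eventually_abs_sub_taylor_le hgr₁ hT₁ hδ] with z hz
    rw [← e₁]
    linarith [hfg₁ z, (abs_le.1 hz).2]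
  · intro δ hδ
    filter_upwards [eventually_abs_sub_taylor_le hgr₂ hT₂ hδ] with z hz
    rw [← e₂]
    linarith [hfg₂ z, (abs_le.1 hz).2]

end SecondOrder

/-! ### Symmetric matrices as quadratic forms. -/

section SymmetricMatrices

variable {n : ℕ}

local notation "⟪" x ", " y "⟫" => inner ℝ x y

theorem posSemidef_iff_forall_inner {A : Matrix (Fin n) (Fin n) ℝ} (hA : A.IsSymm) :
    A.PosSemidef ↔ ∀ h : EuclideanSpace ℝ (Fin n), 0 ≤ ⟪h, Matrix.toEuclideanCLM (𝕜 := ℝ) A h⟫ := by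
  rw [Matrix.posSemidef_iff_dotProduct_mulVec]
  constructor
  · rintro ⟨-, h⟩ x
    rw [Matrix.inner_toEuclideanCLM]
    simpa using h x.ofLp
  · intro h
    refine ⟨?_, fun x => ?_⟩
    · rw [Matrix.IsHermitian, Matrix.conjTranspose_eq_transpose_of_trivial]
      exact hA
    · have := h (WithLp.toLp 2 x)
      rw [Matrix.inner_toEuclideanCLM] at this
      simpa using this

theorem inner_toEuclideanCLM_symm (A : SymMat n) (v w : EuclideanSpace ℝ (Fin n)) :
    ⟪Matrix.toEuclideanCLM (𝕜 := ℝ) (A : Matrix (Fin n) (Fin n) ℝ) v, w⟫ =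
      ⟪v, Matrix.toEuclideanCLM (𝕜 := ℝ) (A : Matrix (Fin n) (Fin n) ℝ) w⟫ := by
  have hA : (A : Matrix (Fin n) (Fin n) ℝ).transpose = A := A.2
  rw [real_inner_comm, Matrix.inner_toEuclideanCLM, Matrix.inner_toEuclideanCLM,
    Matrix.dotProduct_mulVec, ← Matrix.mulVec_transpose, hA, dotProduct_comm]

theorem inner_single_toEuclideanCLM (A : Matrix (Fin n) (Fin n) ℝ) (i j : Fin n) :
    ⟪EuclideanSpace.single i (1 : ℝ), Matrix.toEuclideanCLM (𝕜 := ℝ) A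
      (EuclideanSpace.single j 1)⟫ = A i j := by
  rw [Matrix.inner_toEuclideanCLM]
  simp

theorem exists_symMat_of_symmetric {T : EuclideanSpace ℝ (Fin n) →L[ℝ] EuclideanSpace ℝ (Fin n)}
    (hT : ∀ v w, ⟪T v, w⟫ = ⟪v, T w⟫) :
    ∃ A : SymMat n, Matrix.toEuclideanCLM (𝕜 := ℝ) (A : Matrix (Fin n) (Fin n) ℝ) = T := by
  obtain ⟨B, rfl⟩ := (Matrix.toEuclideanCLM (n := Fin n) (𝕜 := ℝ)).surjective T
  refine ⟨⟨B, Matrix.IsSymm.ext fun i j => ?_⟩, rfl⟩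
  rw [← inner_single_toEuclideanCLM B j i, ← inner_single_toEuclideanCLM B i j, real_inner_comm]
  exact hT _ _

/-- The identity matrix as an element of `Sym(n)`. -/
def symOne (n : ℕ) : SymMat n := ⟨1, Matrix.isSymm_one⟩

theorem inner_toEuclideanCLM_symOne (c : ℝ) (h : EuclideanSpace ℝ (Fin n)) :
    ⟪h, Matrix.toEuclideanCLM (𝕜 := ℝ) ((c • symOne n : SymMat n) : Matrix (Fin n) (Fin n) ℝ) h⟫ =
      c * ‖h‖ ^ 2 := by
  have : ((c • symOne n : SymMat n) : Matrix (Fin n) (Fin n) ℝ) = c • 1 := rfl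
  rw [this, map_smul, map_one, smul_apply, inner_smul_right]
  simp

theorem inner_toEuclideanCLM_smul_one (c : ℝ) (h : EuclideanSpace ℝ (Fin n)) :
    ⟪h, Matrix.toEuclideanCLM (𝕜 := ℝ) (c • 1 : Matrix (Fin n) (Fin n) ℝ) h⟫ = c * ‖h‖ ^ 2 :=
  inner_toEuclideanCLM_symOne c h

theorem continuous_toEuclideanCLM :
    Continuous fun A : SymMat n =>
      Matrix.toEuclideanCLM (𝕜 := ℝ) (A : Matrix (Fin n) (Fin n) ℝ) := by
  have : Continuous fun A : Matrix (Fin n) (Fin n) ℝ => Matrix.toEuclideanCLM (𝕜 := ℝ) A :=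
    (Matrix.toEuclideanCLM (n := Fin n) (𝕜 := ℝ)).toAlgEquiv.toLinearMap.continuous_of_finiteDimensional
  exact this.comp continuous_subtype_val

theorem mem_coneR_iff {R : ℝ} {J : Jet n} : J ∈ coneR n R ↔
    ∀ h, ‖J.2.1‖ / R * ‖h‖ ^ 2 ≤
      ⟪h, Matrix.toEuclideanCLM (𝕜 := ℝ) (J.2.2 : Matrix (Fin n) (Fin n) ℝ) h⟫ := by
  have hs : ((J.2.2 : Matrix (Fin n) (Fin n) ℝ) -
      (‖J.2.1‖ / R) • (1 : Matrix (Fin n) (Fin n) ℝ)).IsSymm :=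
    (J.2.2 - (‖J.2.1‖ / R) • symOne n).2
  change Matrix.PosSemidef _ ↔ _
  rw [posSemidef_iff_forall_inner hs]
  refine forall_congr' fun h => ?_
  rw [map_sub, sub_apply, inner_sub_right, inner_toEuclideanCLM_smul_one,
    sub_nonneg]

end SymmetricMatrices

/-! ### Test jets, duality and interiors of the constraint sets. -/

section Jets

variable {n : ℕ}

local notation "⟪" x ", " y "⟫" => inner ℝ x y

/-- The viscosity test with a quadratic function. -/
theorem IsSubharmonicAt.mem_of_quadratic {F : Set (Jet n)} {u : EuclideanSpace ℝ (Fin n) → EReal}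
    {x₀ p : EuclideanSpace ℝ (Fin n)} {a : ℝ} {A : SymMat n} (h : IsSubharmonicAt F u x₀)
    (hu : ∀ᶠ x in 𝓝 x₀, u x ≤ ((a + ⟪p, x - x₀⟫ + 1 / 2 * ⟪x - x₀,
      Matrix.toEuclideanCLM (𝕜 := ℝ) (A : Matrix (Fin n) (Fin n) ℝ) (x - x₀)⟫ : ℝ) : EReal))
    (ha : u x₀ = (a : EReal)) : (a, p, A) ∈ F := by
  set T := Matrix.toEuclideanCLM (𝕜 := ℝ) (A : Matrix (Fin n) (Fin n) ℝ) with hT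
  have hsymm := inner_toEuclideanCLM_symm A
  set φ : EuclideanSpace ℝ (Fin n) → ℝ :=
    fun x => a + ⟪p, x - x₀⟫ + 1 / 2 * ⟪x - x₀, T (x - x₀)⟫ with hφ
  have hgrad : ∀ z, HasGradientAt φ (p + T (z - x₀)) z := hasGradientAt_quadratic hsymm a p x₀
  have hcd : ContDiff ℝ 2 φ := by
    have h1 : ContDiff ℝ 2 fun x : EuclideanSpace ℝ (Fin n) => x - x₀ := contDiff_id.sub contDiff_const
    exact (contDiff_const.add (contDiff_const.inner ℝ h1)).add
      (contDiff_const.mul (h1.inner ℝ (T.contDiff.comp h1)))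
  have hmem := h φ hcd.contDiffAt hu (by simp [hφ, ha])
  have hfd : fderiv ℝ φ = fun z => (isBoundedBilinearMap_inner (𝕜 := ℝ)
      (E := EuclideanSpace ℝ (Fin n))).toContinuousLinearMap (p + T (z - x₀)) := by
    ext z w
    rw [(hgrad z).hasFDerivAt.fderiv]
    rfl
  have hfd2 : fderiv ℝ (fderiv ℝ φ) x₀ = (isBoundedBilinearMap_inner (𝕜 := ℝ)
      (E := EuclideanSpace ℝ (Fin n))).toContinuousLinearMap.comp T := by
    rw [hfd]
    have h1 : HasFDerivAt (fun z => p + T (z - x₀)) T x₀ := by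
      have := (T.hasFDerivAt.comp x₀ ((hasFDerivAt_id x₀).sub_const x₀)).const_add p
      exact this
    exact (((isBoundedBilinearMap_inner (𝕜 := ℝ)
      (E := EuclideanSpace ℝ (Fin n))).toContinuousLinearMap).hasFDerivAt.comp x₀ h1).fderiv
  have hjet : jetOf φ x₀ hcd.contDiffAt = (a, p, A) := by
    refine Prod.ext ?_ (Prod.ext ?_ (Subtype.ext ?_))
    · simp [jetOf, hφ]
    · simp only [jetOf]
      rw [(hgrad x₀).gradient]
      simp
    · ext i j
      simp only [jetOf, hessianMatrix, Matrix.of_apply]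
      rw [hfd2]
      change ⟪T (EuclideanSpace.single i 1), EuclideanSpace.single j 1⟫ = _
      rw [hT, hsymm, inner_single_toEuclideanCLM]
  rwa [hjet] at hmem

/-- Second-order upper test jets belong to a closed constraint set. -/
theorem IsSubharmonicAt.mem_of_taylor {F : Set (Jet n)} (hF : IsClosed F)
    {u : EuclideanSpace ℝ (Fin n) → EReal}
    {x₀ p : EuclideanSpace ℝ (Fin n)} {a : ℝ} {A : SymMat n} (h : IsSubharmonicAt F u x₀)
    (hu : ∀ δ > 0, ∀ᶠ x in 𝓝 x₀, u x ≤ ((a + ⟪p, x - x₀⟫ + 1 / 2 * ⟪x - x₀,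
      Matrix.toEuclideanCLM (𝕜 := ℝ) (A : Matrix (Fin n) (Fin n) ℝ) (x - x₀)⟫ +
        δ * ‖x - x₀‖ ^ 2 : ℝ) : EReal))
    (ha : u x₀ = (a : EReal)) : (a, p, A) ∈ F := by
  -- The error `δ ‖x - x₀‖²` is absorbed into the Hessian as `2δ I`, which disappears in the limit
  -- since `F` is closed.
  have hlim : Filter.Tendsto (fun δ : ℝ => ((a, p, A + (2 * δ) • symOne n) : Jet n)) (𝓝[>] 0)
      (𝓝 (a, p, A)) := by
    have hc : Continuous fun δ : ℝ => ((a, p, A + (2 * δ) • symOne n) : Jet n) := by fun_prop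
    have := hc.tendsto 0
    simp only [mul_zero, zero_smul, add_zero] at this
    exact this.mono_left nhdsWithin_le_nhds
  refine hF.mem_of_tendsto hlim ?_
  filter_upwards [self_mem_nhdsWithin] with δ hδ
  refine h.mem_of_quadratic ?_ ha
  filter_upwards [hu δ hδ] with x hx
  refine hx.trans (le_of_eq ?_)
  congr 1
  rw [Submodule.coe_add, map_add, add_apply, inner_add_right,
    inner_toEuclideanCLM_symOne]
  ring

theorem IsSubequation.isClosed {F : Set (Jet n)} (hF : IsSubequation F) : IsClosed F := by
  rw [hF.topological]; exact isClosed_closure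

theorem isClosed_dirichletDual (F : Set (Jet n)) : IsClosed (dirichletDual F) :=
  (isOpen_interior.preimage continuous_neg).isClosed_compl

/-- The translate `J + interior M` is open and contained in `F`. -/
theorem IsMonotoneFor.add_mem_interior {F M : Set (Jet n)} (h : IsMonotoneFor F M) {J K : Jet n}
    (hJ : J ∈ F) (hK : K ∈ interior M) : J + K ∈ interior F := by
  refine mem_interior.2 ⟨(fun K => J + K) '' interior M, ?_,
    (isOpenMap_add_left J) _ isOpen_interior, Set.mem_image_of_mem _ hK⟩
  rintro _ ⟨L, hL, rfl⟩
  exact h J hJ L (interior_subset hL)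

/-- All three constraints hold strictly. Half of the slack `c` absorbs the variation of `‖p‖ / R`,
the other half that of `A` in operator norm. -/
theorem mem_interior_coneGDR {γ R c r : ℝ} {D : Set (EuclideanSpace ℝ (Fin n))}
    {p : EuclideanSpace ℝ (Fin n)} {A : SymMat n} (hc : 0 < c) (hr : r < -γ * ‖p‖)
    (hp : p ∈ interior D) (hA : ∀ h, (‖p‖ / R + c) * ‖h‖ ^ 2 ≤
      ⟪h, Matrix.toEuclideanCLM (𝕜 := ℝ) (A : Matrix (Fin n) (Fin n) ℝ) h⟫) :
    ((r, p, A) : Jet n) ∈ interior (coneGDR γ D R) := by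
  rw [mem_interior_iff_mem_nhds]
  have c1 : Continuous fun J : Jet n => J.1 := continuous_fst
  have c2 : Continuous fun J : Jet n => J.2.1 := continuous_fst.comp continuous_snd
  have c3 : Continuous fun J : Jet n => J.2.2 := continuous_snd.comp continuous_snd
  have e1 : ∀ᶠ J : Jet n in 𝓝 (r, p, A), J.1 < -γ * ‖J.2.1‖ :=
    (isOpen_lt c1 (continuous_const.mul c2.norm)).mem_nhds hr
  have e2 : ∀ᶠ J : Jet n in 𝓝 (r, p, A), J.2.1 ∈ interior D :=
    (isOpen_interior.preimage c2).mem_nhds hp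
  have e3 : ∀ᶠ J : Jet n in 𝓝 (r, p, A), ‖J.2.1‖ / R < ‖p‖ / R + c / 2 :=
    (isOpen_lt (c2.norm.div_const R) continuous_const).mem_nhds
      (show ‖p‖ / R < ‖p‖ / R + c / 2 by linarith)
  have c4 : Continuous fun J : Jet n => Matrix.toEuclideanCLM (𝕜 := ℝ)
      (J.2.2 : Matrix (Fin n) (Fin n) ℝ) := continuous_toEuclideanCLM.comp c3
  have e4 : ∀ᶠ J : Jet n in 𝓝 (r, p, A),
      ‖Matrix.toEuclideanCLM (𝕜 := ℝ) (J.2.2 : Matrix (Fin n) (Fin n) ℝ) -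
        Matrix.toEuclideanCLM (𝕜 := ℝ) (A : Matrix (Fin n) (Fin n) ℝ)‖ < c / 2 :=
    (isOpen_lt (c4.sub continuous_const).norm
      continuous_const).mem_nhds (by
        simpa only [Set.mem_ofPred_eq, Pi.sub_apply, sub_self, norm_zero] using half_pos hc)
  filter_upwards [e1, e2, e3, e4] with J h1 h2 h3 h4
  refine ⟨⟨h1.le, (interior_subset h2 : J.2.1 ∈ D)⟩, mem_coneR_iff.2 fun h => ?_⟩
  set S := Matrix.toEuclideanCLM (𝕜 := ℝ) (J.2.2 : Matrix (Fin n) (Fin n) ℝ)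
  set T := Matrix.toEuclideanCLM (𝕜 := ℝ) (A : Matrix (Fin n) (Fin n) ℝ)
  have h5 : |⟪h, (S - T) h⟫| ≤ c / 2 * ‖h‖ ^ 2 :=
    calc |⟪h, (S - T) h⟫| ≤ ‖h‖ * ‖(S - T) h‖ := abs_real_inner_le_norm _ _
      _ ≤ ‖h‖ * (‖S - T‖ * ‖h‖) := by gcongr; exact (S - T).le_opNorm h
      _ = ‖S - T‖ * ‖h‖ ^ 2 := by ring
      _ ≤ c / 2 * ‖h‖ ^ 2 := by gcongr
  rw [sub_apply, inner_sub_right] at h5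
  have h6 := (abs_le.1 h5).1
  have h7 := hA h
  have h8 := mul_le_mul_of_nonneg_right h3.le (sq_nonneg ‖h‖)
  linarith

end Jets

/-! ### Sup-convolutions. -/

section SupConvolution

variable {E : Type*} [NormedAddCommGroup E]

/-- A sum of an upper semicontinuous function and a continuous one attains its maximum. -/
theorem UpperSemicontinuousOn.exists_max_add {X : Type*} [TopologicalSpace X] {u : X → EReal}
    {K : Set X} (hK : IsCompact K) (hu : UpperSemicontinuousOn u K) (htop : ∀ x ∈ K, u x ≠ ⊤)
    {x₁ : X} (hx₁ : x₁ ∈ K) (hbot : u x₁ ≠ ⊥) {h : X → ℝ} (hh : Continuous h) :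
    ∃ y ∈ K, ∃ c : ℝ, u y = ((c - h y : ℝ) : EReal) ∧ ∀ z ∈ K, u z ≤ ((c - h z : ℝ) : EReal) := by
  have husc : UpperSemicontinuousOn (fun x => u x + (h x : EReal)) K := by
    refine hu.add' ?_ fun x _ => EReal.continuousAt_add (by simp) (by simp)
    exact (continuous_coe_real_ereal.comp hh).upperSemicontinuous.upperSemicontinuousOn K
  obtain ⟨y, hy, hmax⟩ := husc.exists_isMaxOn ⟨x₁, hx₁⟩ hK
  have hybot : u y ≠ ⊥ := by
    intro h0
    have := hmax hx₁
    simp only [Set.mem_ofPred_eq, h0, EReal.bot_add, le_bot_iff, EReal.add_eq_bot_iff,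
      EReal.coe_ne_bot, or_false] at this
    exact hbot this
  lift u y to ℝ using ⟨htop y hy, hybot⟩ with a ha
  refine ⟨y, hy, a + h y, by rw [add_sub_cancel_right, ← ha], fun z hz => ?_⟩
  have := hmax hz
  simp only [Set.mem_ofPred_eq, ← ha] at this
  by_cases hzb : u z = ⊥
  · rw [hzb]; exact bot_le
  lift u z to ℝ using ⟨htop z hz, hzb⟩ with b hb
  norm_cast at this ⊢
  linarith

/-- `U` is the sup-convolution `x ↦ sup_{z ∈ K} (u z - κ |x - z|²)`, attained at `Y x`. -/
def IsSupConvolution (κ : ℝ) (K : Set E) (u : E → EReal) (U : E → ℝ) (Y : E → E) : Prop :=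
  ∀ x, Y x ∈ K ∧ u (Y x) = ((U x + κ * ‖x - Y x‖ ^ 2 : ℝ) : EReal) ∧
    ∀ z ∈ K, u z ≤ ((U x + κ * ‖x - z‖ ^ 2 : ℝ) : EReal)

theorem UpperSemicontinuousOn.exists_supConvolution {u : E → EReal} {K : Set E}
    (hK : IsCompact K) (hu : UpperSemicontinuousOn u K) (htop : ∀ x ∈ K, u x ≠ ⊤)
    {x₁ : E} (hx₁ : x₁ ∈ K) (hbot : u x₁ ≠ ⊥) (κ : ℝ) :
    ∃ U Y, IsSupConvolution κ K u U Y := by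
  have : ∀ x, ∃ y ∈ K, ∃ c : ℝ, u y = ((c + κ * ‖x - y‖ ^ 2 : ℝ) : EReal) ∧
      ∀ z ∈ K, u z ≤ ((c + κ * ‖x - z‖ ^ 2 : ℝ) : EReal) := by
    intro x
    have := hu.exists_max_add hK htop hx₁ hbot (h := fun z => -(κ * ‖x - z‖ ^ 2)) (by fun_prop)
    simpa only [sub_neg_eq_add] using this
  choose Y hY U h1 h2 using this
  exact ⟨U, Y, fun x => ⟨hY x, h1 x, h2 x⟩⟩

namespace IsSupConvolution

variable {κ : ℝ} {K : Set E} {u : E → EReal} {U : E → ℝ} {Y : E → E}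

theorem add_le (h : IsSupConvolution κ K u U Y) {C : ℝ} (hC : ∀ z ∈ K, u z ≤ (C : EReal)) (x : E) :
    U x + κ * ‖x - Y x‖ ^ 2 ≤ C := by
  have := hC _ (h x).1
  rw [(h x).2.1] at this
  exact_mod_cast this

theorem le_apply (h : IsSupConvolution κ K u U Y) {x : E} {a : ℝ} (hx : x ∈ K)
    (ha : u x = (a : EReal)) : a ≤ U x := by
  have := (h x).2.2 x hx
  rw [ha] at this
  norm_cast at this
  simpa using this

variable [InnerProductSpace ℝ E]

local notation "⟪" x ", " y "⟫" => inner ℝ x y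

/-- A supremum of the functions `c - κ |· - z|²` inherits their semiconvexity: use the maximizer for
the intermediate point `w` as a competitor at both endpoints. -/
theorem strongConvexOn (h : IsSupConvolution κ K u U Y) :
    StrongConvexOn Set.univ (-(2 * κ)) U := by
  refine ⟨convex_univ, fun x _ y _ a b ha hb hab => ?_⟩
  set w := a • x + b • y with hw
  obtain ⟨hYK, he, -⟩ := h w
  have h1 := (h x).2.2 _ hYK
  have h2 := (h y).2.2 _ hYK
  rw [he] at h1 h2
  norm_cast at h1 h2
  have e : ‖w - Y w‖ ^ 2 = a * ‖x - Y w‖ ^ 2 + b * ‖y - Y w‖ ^ 2 - a * b * ‖x - y‖ ^ 2 := by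
    have e1 : w - Y w = a • (x - Y w) + b • (y - Y w) := by
      have : a • (x - Y w) + b • (y - Y w) = w - (a + b) • Y w := by rw [hw]; module
      rw [this, hab, one_smul]
    have e2 : x - y = (x - Y w) - (y - Y w) := by abel
    rw [e1, e2]
    generalize x - Y w = s
    generalize y - Y w = t
    rw [norm_add_sq_real, norm_sub_sq_real, inner_smul_left, inner_smul_right, norm_smul,
      norm_smul, mul_pow, mul_pow, Real.norm_eq_abs, Real.norm_eq_abs, sq_abs, sq_abs]
    obtain rfl : b = 1 - a := by linarith
    simp only [conj_trivial]
    ring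
  have h1' := mul_le_mul_of_nonneg_left h1 ha
  have h2' := mul_le_mul_of_nonneg_left h2 hb
  have e3 : a * (U w + κ * ‖w - Y w‖ ^ 2) + b * (U w + κ * ‖w - Y w‖ ^ 2) =
      U w + κ * ‖w - Y w‖ ^ 2 := by rw [← add_mul, hab, one_mul]
  rw [e] at e3 h1' h2'
  simp only [smul_eq_mul]
  nlinarith

theorem continuous [FiniteDimensional ℝ E] (h : IsSupConvolution κ K u U Y) : Continuous U := by
  have h1 := (strongConvexOn_iff_convex.1 h.strongConvexOn).locallyLipschitz.continuous
  have h2 : Continuous fun x : E => -(2 * κ) / (2 : ℝ) * ‖x‖ ^ 2 := by fun_prop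
  have h3 := h1.add h2
  convert h3 using 1
  ext x
  simp only [Pi.add_apply]
  ring

/-- Second-order upper bounds for the sup-convolution at `x` transfer to `u` at `Y x`. -/
theorem eventually_le_of_eventually_le (h : IsSupConvolution κ K u U Y) {x p : E} {T : E →L[ℝ] E}
    {δ : ℝ} (hK : K ∈ 𝓝 (Y x))
    (hU : ∀ᶠ z in 𝓝 x, U z ≤ U x + ⟪p, z - x⟫ + 1 / 2 * ⟪z - x, T (z - x)⟫ + δ * ‖z - x‖ ^ 2) :
    ∀ᶠ z in 𝓝 (Y x), u z ≤ ((U x + κ * ‖x - Y x‖ ^ 2 + ⟪p, z - Y x⟫ +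
      1 / 2 * ⟪z - Y x, T (z - Y x)⟫ + δ * ‖z - Y x‖ ^ 2 : ℝ) : EReal) := by
  have ht : Filter.Tendsto (fun z => z + (x - Y x)) (𝓝 (Y x)) (𝓝 x) := by
    have := (by fun_prop : Continuous fun z => z + (x - Y x)).tendsto (Y x)
    simpa using this
  filter_upwards [ht.eventually hU, hK] with z hz hzK
  -- Testing at `z + (x - Y x)` keeps the penalty constant, so `p` and `T` transfer unchanged.
  have h1 := (h (z + (x - Y x))).2.2 z hzK
  refine h1.trans ?_
  have e1 : z + (x - Y x) - z = x - Y x := by abel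
  have e2 : z + (x - Y x) - x = z - Y x := by abel
  rw [e1]
  rw [e2] at hz
  norm_cast
  linarith

end IsSupConvolution

end SupConvolution

/-! ### The zero maximum principle and comparison. -/

section Principles

variable {n : ℕ}

local notation "⟪" x ", " y "⟫" => inner ℝ x y

theorem coneGDR_subset_coneGDP {γ R : ℝ} (D : Set (EuclideanSpace ℝ (Fin n))) (hR : 0 < R) :
    coneGDR γ D R ⊆ coneGDP γ D := by
  rintro J ⟨hJ, hJR⟩
  refine ⟨hJ, (posSemidef_iff_forall_inner J.2.2.2).2 fun h => ?_⟩
  exact le_trans (by positivity) (mem_coneR_iff.1 hJR h)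

open scoped Pointwise in
/-- Multiples of the jets of `x ↦ |x - q|²/2 - m` are strictly inside `𝓜(γ, 𝒟, R)`. -/
theorem mem_interior_coneGDR_of_quadratic {γ R α r : ℝ} {D : Set (EuclideanSpace ℝ (Fin n))}
    {w : EuclideanSpace ℝ (Fin n)} {A : SymMat n} (hD : IsDirectionalCone D) (hα : 0 < α)
    (hR : 0 < R) (hw : w ∈ interior D) (hwR : ‖w‖ < R) (hr : r < -γ * (α * ‖w‖))
    (hA : ∀ h, α * ‖h‖ ^ 2 ≤
      ⟪h, Matrix.toEuclideanCLM (𝕜 := ℝ) (A : Matrix (Fin n) (Fin n) ℝ) h⟫) :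
    ((r, α • w, A) : Jet n) ∈ interior (coneGDR γ D R) := by
  have hn : ‖α • w‖ = α * ‖w‖ := by rw [norm_smul, Real.norm_of_nonneg hα.le]
  have hwR' : ‖w‖ / R < 1 := (div_lt_one hR).2 hwR
  refine mem_interior_coneGDR (c := α * (1 - ‖w‖ / R)) (mul_pos hα (by linarith)) (by rwa [hn]) ?_
    fun h => le_trans (le_of_eq ?_) (hA h)
  · have h1 : α • w ∈ α • interior D := Set.smul_mem_smul_set hw
    rw [← interior_smul₀ hα.ne'] at h1
    refine interior_mono ?_ h1
    rintro _ ⟨y, hy, rfl⟩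
    exact hD.isCone α hα.le y hy
  · rw [hn]
    ring

/-- The translate `Ω - y` is open and contained in `D`, hence in its interior. This makes the
gradients of the paraboloid strictly admissible. -/
theorem sub_mem_interior_of_subset_translate {Ω D : Set (EuclideanSpace ℝ (Fin n))} {R : ℝ}
    {y : EuclideanSpace ℝ (Fin n)} (hΩ : IsOpen Ω)
    (h : Ω ⊆ (fun x => y + x) '' (D ∩ Metric.ball 0 R)) {x : EuclideanSpace ℝ (Fin n)}
    (hx : x ∈ Ω) : x - y ∈ interior D ∧ ‖x - y‖ < R := by
  have key : ∀ z ∈ Ω, z - y ∈ D ∧ ‖z - y‖ < R := by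
    intro z hz
    obtain ⟨w, ⟨hwD, hwR⟩, rfl⟩ := h hz
    simp only [add_sub_cancel_left]
    exact ⟨hwD, by simpa using hwR⟩
  refine ⟨mem_interior.2 ⟨(fun w => w + y) ⁻¹' Ω, fun w hw => ?_, hΩ.preimage (by fun_prop), ?_⟩,
    (key x hx).2⟩
  · simpa using (key _ hw).1
  · simpa using hx

theorem norm_sub_le_of_mem_closure {Ω : Set (EuclideanSpace ℝ (Fin n))} {R : ℝ}
    {y : EuclideanSpace ℝ (Fin n)} (h : ∀ x ∈ Ω, ‖x - y‖ < R) {x : EuclideanSpace ℝ (Fin n)}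
    (hx : x ∈ closure Ω) : ‖x - y‖ ≤ R := by
  have : closure Ω ⊆ Metric.closedBall y R := closure_minimal
    (fun z hz => by rw [mem_closedBall_iff_norm]; exact (h z hz).le) Metric.isClosed_closedBall
  simpa [dist_eq_norm] using this hx

theorem isCompact_closure_of_norm_sub_lt {Ω : Set (EuclideanSpace ℝ (Fin n))} {R : ℝ}
    {y : EuclideanSpace ℝ (Fin n)} (h : ∀ x ∈ Ω, ‖x - y‖ < R) : IsCompact (closure Ω) :=
  (Metric.isBounded_ball.subset fun x hx => by
    rw [mem_ball_iff_norm]; exact h x hx : Bornology.IsBounded Ω).isCompact_closure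

/-- A bounded set lies in a translate of a truncation of any directional cone. -/
theorem IsDirectionalCone.exists_inTranslateOfTruncatedCone
    {Ω D : Set (EuclideanSpace ℝ (Fin n))} (hD : IsDirectionalCone D)
    (hΩ : Bornology.IsBounded Ω) : ∃ R, 0 < R ∧ InTranslateOfTruncatedCone Ω D R := by
  obtain ⟨r, hr, hΩr⟩ := hΩ.subset_ball_lt 0 0
  obtain ⟨e, he⟩ := hD.interior_nonempty
  obtain ⟨s, hs, hsD⟩ := Metric.isOpen_iff.1 isOpen_interior e he
  -- The ball of radius `s` about `e` lies in `D`; dilating by `r / s` gives a ball of radius `r`,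
  -- large enough for `Ω`.
  refine ⟨r + ‖(r / s) • e‖, by positivity, -((r / s) • e), fun x hx => ?_⟩
  have hxr : ‖x‖ < r := by simpa using hΩr hx
  refine ⟨x + (r / s) • e, ⟨?_, ?_⟩, by simp⟩
  · have h1 : (s / r) • x + e ∈ D := by
      refine interior_subset (hsD ?_)
      rw [mem_ball_iff_norm, add_sub_cancel_right, norm_smul, Real.norm_of_nonneg (by positivity)]
      calc s / r * ‖x‖ < s / r * r := by gcongr
        _ = s := by field_simp
    have h2 := hD.isCone (r / s) (by positivity) _ h1
    have e1 : (r / s) • ((s / r) • x + e) = x + (r / s) • e := by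
      rw [smul_add, smul_smul, div_mul_div_cancel₀ hs.ne', div_self hr.ne', one_smul]
    rwa [e1] at h2
  · rw [mem_ball_zero_iff]
    exact (norm_add_le _ _).trans_lt (by linarith)

/-- The zero maximum principle for the dual of any set containing `𝓜(γ, 𝒟, R)`. -/
theorem zeroMaximumPrinciple_of_coneGDR_subset {γ R : ℝ} {D : Set (EuclideanSpace ℝ (Fin n))}
    (hγ : 0 ≤ γ) (hD : IsDirectionalCone D) (hR : 0 < R) {M : Set (Jet n)}
    (hM : coneGDR γ D R ⊆ M) {Ω : Set (EuclideanSpace ℝ (Fin n))} (hΩ : IsOpen Ω)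
    (hΩD : InTranslateOfTruncatedCone Ω D R) : ZeroMaximumPrinciple (dirichletDual M) Ω := by
  obtain ⟨y₀, hy₀⟩ := hΩD
  have hin := fun x hx => sub_mem_interior_of_subset_translate hΩ hy₀ (x := x) hx
  have hcpt := isCompact_closure_of_norm_sub_lt fun x hx => (hin x hx).2
  intro z hz hsub hfr x₁ hx₁
  by_contra! hpos
  have hx₁K := subset_closure hx₁
  obtain ⟨b, hb⟩ : ∃ b : ℝ, z x₁ = (b : EReal) := by
    lift z x₁ to ℝ using ⟨hz.2 x₁ hx₁K, (bot_le.trans_lt hpos).ne'⟩ with b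
    exact ⟨b, rfl⟩
  have hb0 : 0 < b := by rw [hb] at hpos; exact_mod_cast hpos
  -- This `m` makes the paraboloid at most `-γ ‖x - y₀‖` on the closure of `Ω`; `α` then costs at
  -- most half of the positive value `b`.
  set m : ℝ := R ^ 2 / 2 + γ * R with hm
  have hm0 : 0 < m := by positivity
  set α : ℝ := b / (2 * m) with hα
  have hα0 : 0 < α := by positivity
  have hαm : α * m = b / 2 := by rw [hα]; field_simp
  obtain ⟨x, hxK, c, hxc, hmax⟩ := hz.1.exists_max_add hcpt hz.2 hx₁K
    (bot_le.trans_lt hpos).ne' (h := fun x => α * (1 / 2 * ‖x - y₀‖ ^ 2 - m)) (by fun_prop)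
  have hc : b / 2 ≤ c := by
    have := hmax x₁ hx₁K
    rw [hb] at this
    norm_cast at this
    have h1 : 0 ≤ α * ‖x₁ - y₀‖ ^ 2 := by positivity
    linarith
  have hψ : ∀ y ∈ closure Ω, 1 / 2 * ‖y - y₀‖ ^ 2 - m ≤ -γ * ‖y - y₀‖ := by
    intro y hy
    have h1 := norm_sub_le_of_mem_closure (fun x hx => (hin x hx).2) hy
    have h2 : ‖y - y₀‖ ^ 2 ≤ R ^ 2 := by gcongr
    have h3 : γ * ‖y - y₀‖ ≤ γ * R := by gcongr
    rw [hm]; linarith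
  have hxΩ : x ∈ Ω := by
    by_contra hnot
    have h1 := hfr x (by rw [hΩ.frontier_eq]; exact ⟨hxK, hnot⟩)
    rw [hxc] at h1
    norm_cast at h1
    have h2 := mul_le_mul_of_nonneg_left (hψ x hxK) hα0.le
    have h3 : 0 ≤ α * (γ * ‖x - y₀‖) := by positivity
    linarith
  obtain ⟨hxD, hxR⟩ := hin x hxΩ
  have hmem := (hsub x hxΩ).mem_of_quadratic (p := -(α • (x - y₀))) (A := (-α) • symOne n) ?_ hxc
  · refine hmem (interior_mono hM ?_)
    have e : -((c - α * (1 / 2 * ‖x - y₀‖ ^ 2 - m), -(α • (x - y₀)), (-α) • symOne n) : Jet n) =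
        (α * (1 / 2 * ‖x - y₀‖ ^ 2 - m) - c, α • (x - y₀), α • symOne n) := by
      have e1 : -((-α) • symOne n) = α • symOne n := by module
      rw [Prod.neg_mk, Prod.neg_mk, e1, neg_neg, neg_sub]
    rw [e]
    refine mem_interior_coneGDR_of_quadratic hD hα0 hR hxD hxR ?_ fun h =>
      (inner_toEuclideanCLM_symOne α h).ge
    have h2 := mul_le_mul_of_nonneg_left (hψ x hxK) hα0.le
    linarith
  · filter_upwards [hΩ.mem_nhds hxΩ] with y hy
    refine (hmax y (subset_closure hy)).trans (le_of_eq ?_)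
    congr 1
    have e1 : y - y₀ = (x - y₀) + (y - x) := by abel
    rw [inner_toEuclideanCLM_symOne, inner_neg_left, inner_smul_left, e1, norm_add_sq_real]
    simp only [conj_trivial]
    ring

/-- If `u + v ≤ 0` on the boundary, then points `y, y'` that are close to each other and at which
`u y + v y' ≥ η > 0` stay away from the boundary. -/
theorem exists_ball_subset_of_le_add {Ω : Set (EuclideanSpace ℝ (Fin n))} (hΩ : IsOpen Ω)
    (hcpt : IsCompact (closure Ω)) {u v : EuclideanSpace ℝ (Fin n) → EReal}
    (hu : IsUSC u (closure Ω)) (hv : IsUSC v (closure Ω))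
    (hfr : ∀ x ∈ frontier Ω, u x + v x ≤ 0) {η : ℝ} (hη : 0 < η) :
    ∃ δ : ℝ, 0 < δ ∧ δ ≤ 1 ∧ ∀ y ∈ closure Ω, ∀ y' ∈ closure Ω, dist y y' < 2 * δ →
      (η : EReal) ≤ u y + v y' → Metric.ball y (2 * δ) ⊆ Ω := by
  by_contra! hcon
  have hstep : ∀ k : ℕ, ∃ y ∈ closure Ω, ∃ y' ∈ closure Ω, ∃ z,
      dist y y' < 2 * (1 / ((k : ℝ) + 1)) ∧ (η : EReal) ≤ u y + v y' ∧
      dist z y < 2 * (1 / ((k : ℝ) + 1)) ∧ z ∉ Ω := by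
    intro k
    obtain ⟨y, hy, y', hy', h1, h2, h3⟩ := hcon (1 / ((k : ℝ) + 1)) (by positivity)
      ((div_le_one (by positivity)).2 (by linarith [(k.cast_nonneg : (0 : ℝ) ≤ k)]))
    obtain ⟨z, hz, hzΩ⟩ := Set.not_subset.1 h3
    exact ⟨y, hy, y', hy', z, h1, h2, hz, hzΩ⟩
  choose y hy y' hy' z h1 h2 h3 h4 using hstep
  obtain ⟨a, ha, φ, hφ, hlim⟩ := hcpt.tendsto_subseq hy
  have hsmall : Filter.Tendsto (fun k => 2 * (1 / ((φ k : ℝ) + 1))) Filter.atTop (𝓝 0) := by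
    have := (tendsto_one_div_add_atTop_nhds_zero_nat (𝕜 := ℝ)).const_mul 2
    rw [mul_zero] at this
    exact this.comp hφ.tendsto_atTop
  have hlim' : Filter.Tendsto (fun k => y' (φ k)) Filter.atTop (𝓝 a) := by
    refine (tendsto_iff_of_dist (f₁ := y ∘ φ) ?_).1 hlim
    exact squeeze_zero (fun _ => dist_nonneg) (fun k => (h1 (φ k)).le) hsmall
  have hlimz : Filter.Tendsto (fun k => z (φ k)) Filter.atTop (𝓝 a) := by
    refine (tendsto_iff_of_dist (f₁ := y ∘ φ) ?_).1 hlim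
    refine squeeze_zero (fun _ => dist_nonneg) (fun k => ?_) hsmall
    rw [dist_comm]
    exact (h3 (φ k)).le
  have haΩ : a ∉ Ω := hΩ.isClosed_compl.mem_of_tendsto hlimz
    (Filter.Eventually.of_forall fun k => h4 (φ k))
  have hafr := hfr a (by rw [hΩ.frontier_eq]; exact ⟨ha, haΩ⟩)
  -- Both sequences converge to the boundary point `a`, where `u a + v a ≤ 0`; joint upper
  -- semicontinuity contradicts the lower bound by the positive level.
  have husc : UpperSemicontinuousOn (fun p : EuclideanSpace ℝ (Fin n) × EuclideanSpace ℝ (Fin n) =>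
      u p.1 + v p.2) (closure Ω ×ˢ closure Ω) := by
    refine UpperSemicontinuousOn.add' ?_ ?_ ?_
    · intro p hp c hc
      exact (continuousWithinAt_fst.tendsto_nhdsWithin fun q hq => hq.1).eventually
        (hu.1 p.1 hp.1 c hc)
    · intro p hp c hc
      exact (continuousWithinAt_snd.tendsto_nhdsWithin fun q hq => hq.2).eventually
        (hv.1 p.2 hp.2 c hc)
    · exact fun p hp => EReal.continuousAt_add (.inl (hu.2 _ hp.1)) (.inr (hv.2 _ hp.2))
  have hev := husc (a, a) ⟨ha, ha⟩ (η : EReal) (hafr.trans_lt (by exact_mod_cast hη))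
  have ht : Filter.Tendsto (fun k => (y (φ k), y' (φ k))) Filter.atTop
      (𝓝[closure Ω ×ˢ closure Ω] (a, a)) :=
    tendsto_nhdsWithin_iff.2 ⟨hlim.prodMk_nhds hlim',
      Filter.Eventually.of_forall fun k => ⟨hy _, hy' _⟩⟩
  obtain ⟨k, hk⟩ := (ht.eventually hev).exists
  exact (h2 (φ k)).not_gt hk

/-- A continuous function bounded above by `N - κ |z - y|²` for suitable `y` in a bounded set attains
its maximum. -/
theorem exists_forall_le_of_le_sub_sq {E : Type*} [NormedAddCommGroup E] [ProperSpace E]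
    {Ψ : E → ℝ} (hΨ : Continuous Ψ) {κ N B : ℝ} (hκ : 0 < κ) {q : E} {Y : E → E}
    (hY : ∀ z, ‖Y z - q‖ ≤ B) (hle : ∀ z, Ψ z + κ * ‖z - Y z‖ ^ 2 ≤ N) :
    ∃ x, ∀ z, Ψ z ≤ Ψ x := by
  refine hΨ.exists_forall_ge' q ?_
  have hev : ∀ᶠ z in Filter.cocompact E, z ∉ Metric.closedBall q (B + (|N - Ψ q| / κ + 1)) :=
    (ProperSpace.isCompact_closedBall q _).compl_mem_cocompact
  filter_upwards [hev] with z hz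
  rw [mem_closedBall_iff_norm, not_le] at hz
  have h1 : ‖z - q‖ ≤ ‖z - Y z‖ + ‖Y z - q‖ := by
    simpa using norm_add_le (z - Y z) (Y z - q)
  set t := |N - Ψ q| / κ with ht
  have ht0 : 0 ≤ t := by positivity
  -- The extra `1` in the radius gives `(t + 1)² ≥ t`, so the penalty exceeds `N - Ψ q`.
  have h2 : t + 1 ≤ ‖z - Y z‖ := by linarith [hY z]
  have h3 : t ≤ ‖z - Y z‖ ^ 2 := by nlinarith
  have h4 := mul_le_mul_of_nonneg_left h3 hκ.le
  have h5 : κ * t = |N - Ψ q| := by rw [ht]; field_simp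
  linarith [hle z, le_abs_self (N - Ψ q)]

/-- The comparison principle for `M`-monotone constraint sets when `M` contains `𝓜(γ, 𝒟, R)`. -/
theorem comparisonPrinciple_of_coneGDR_subset {γ R : ℝ} {D : Set (EuclideanSpace ℝ (Fin n))}
    (hγ : 0 ≤ γ) (hD : IsDirectionalCone D) (hR : 0 < R) {F M : Set (Jet n)}
    (hF : IsClosed F) (hFM : IsMonotoneFor F M)
    (hM : coneGDR γ D R ⊆ M) {Ω : Set (EuclideanSpace ℝ (Fin n))} (hΩ : IsOpen Ω)
    (hΩD : InTranslateOfTruncatedCone Ω D R) : ComparisonPrinciple F Ω := by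
  obtain ⟨y₀, hy₀⟩ := hΩD
  have hin := fun x hx => sub_mem_interior_of_subset_translate hΩ hy₀ (x := x) hx
  have hcpt := isCompact_closure_of_norm_sub_lt fun x hx => (hin x hx).2
  intro u v hu hv hsubu hsubv hfr x₁ hx₁
  by_contra! hpos
  have hx₁K := subset_closure hx₁
  have hu₁ : u x₁ ≠ ⊥ := fun h => by simp [h] at hpos
  have hv₁ : v x₁ ≠ ⊥ := fun h => by simp [h] at hpos
  obtain ⟨a, ha⟩ : ∃ a : ℝ, u x₁ = (a : EReal) := by
    lift u x₁ to ℝ using ⟨hu.2 x₁ hx₁K, hu₁⟩ with a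
    exact ⟨a, rfl⟩
  obtain ⟨b, hb⟩ : ∃ b : ℝ, v x₁ = (b : EReal) := by
    lift v x₁ to ℝ using ⟨hv.2 x₁ hx₁K, hv₁⟩ with b
    exact ⟨b, rfl⟩
  obtain ⟨η, hη⟩ : ∃ η : ℝ, η = a + b := ⟨_, rfl⟩
  have hη0 : 0 < η := by
    rw [ha, hb] at hpos
    rw [hη]
    exact_mod_cast hpos
  obtain ⟨δ, hδ0, hδ1, hδ⟩ := exists_ball_subset_of_le_add hΩ hcpt hu hv hfr (half_pos hη0)
  obtain ⟨-, -, C₁, -, hC₁⟩ := hu.1.exists_max_add hcpt hu.2 hx₁K hu₁ (h := fun _ => 0)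
    continuous_const
  obtain ⟨-, -, C₂, -, hC₂⟩ := hv.1.exists_max_add hcpt hv.2 hx₁K hv₁ (h := fun _ => 0)
    continuous_const
  simp only [sub_zero] at hC₁ hC₂
  -- `R + 2` is the a priori bound for `‖x - q‖`; the sharper bound `R`, used in the term `γ * R`,
  -- is available once `x - q + y₀` is known to lie in `Ω`.
  obtain ⟨m, hm⟩ : ∃ m : ℝ, m = (R + 2) ^ 2 / 2 + γ * R := ⟨_, rfl⟩
  have hm0 : 0 < m := by rw [hm]; positivity
  obtain ⟨α, hα⟩ : ∃ α : ℝ, α = η / (2 * m) := ⟨_, rfl⟩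
  have hα0 : 0 < α := by rw [hα]; positivity
  have hαm : α * m = η / 2 := by rw [hα]; field_simp
  obtain ⟨N, hN⟩ : ∃ N : ℝ, N = C₁ + C₂ + α * (R + 1) ^ 2 := ⟨_, rfl⟩
  -- `α ≤ κ` lets one penalty dominate the added paraboloid, so maxima exist; `N ≤ κ * δ ^ 2` forces
  -- the maximum point within `δ` of `Y x` and `Y' x`.
  obtain ⟨κ, hκα, hκN⟩ : ∃ κ : ℝ, α ≤ κ ∧ N ≤ κ * δ ^ 2 := by
    refine ⟨max α (N / δ ^ 2), le_max_left _ _, ?_⟩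
    calc N = N / δ ^ 2 * δ ^ 2 := by field_simp
      _ ≤ _ := by gcongr; exact le_max_right _ _
  have hκ0 : 0 < κ := hα0.trans_le hκα
  obtain ⟨U, Y, hU⟩ := hu.1.exists_supConvolution hcpt hu.2 hx₁K hu₁ κ
  obtain ⟨V, Y', hV⟩ := hv.1.exists_supConvolution hcpt hv.2 hx₁K hv₁ κ
  have hYq : ∀ q ∈ Metric.ball y₀ δ, ∀ y ∈ closure Ω, ‖y - q‖ ≤ R + 1 := by
    intro q hq y hy
    have h1 := norm_sub_le_of_mem_closure (fun x hx => (hin x hx).2) hy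
    have h2 : ‖y₀ - q‖ < δ := by rw [← dist_eq_norm, dist_comm]; exact hq
    have h3 : ‖y - q‖ ≤ ‖y - y₀‖ + ‖y₀ - q‖ := by simpa using norm_add_le (y - y₀) (y₀ - q)
    linarith
  have hquad : ∀ q ∈ Metric.ball y₀ δ, ∀ y ∈ closure Ω, ∀ z : EuclideanSpace ℝ (Fin n),
      α / 2 * ‖z - q‖ ^ 2 ≤ κ * ‖z - y‖ ^ 2 + α * (R + 1) ^ 2 := by
    intro q hq y hy z
    have h1 := hYq q hq y hy
    have h3 : ‖z - q‖ ≤ ‖z - y‖ + ‖y - q‖ := by simpa using norm_add_le (z - y) (y - q)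
    have h4 : ‖z - q‖ ≤ ‖z - y‖ + (R + 1) := by linarith
    have h5 : ‖z - q‖ ^ 2 ≤ 2 * ‖z - y‖ ^ 2 + 2 * (R + 1) ^ 2 := by
      calc ‖z - q‖ ^ 2 ≤ (‖z - y‖ + (R + 1)) ^ 2 := by gcongr
        _ ≤ _ := by nlinarith [sq_nonneg (‖z - y‖ - (R + 1))]
    have h6 := mul_le_mul_of_nonneg_left h5 (half_pos hα0).le
    have h7 := mul_le_mul_of_nonneg_right hκα (sq_nonneg ‖z - y‖)
    linarith
  have hUV₁ : ∀ q ∈ Metric.ball y₀ δ, ∀ z,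
      U z + V z + α / 2 * ‖z - q‖ ^ 2 + κ * ‖z - Y z‖ ^ 2 ≤ N := by
    intro q hq z
    have h1 := hU.add_le hC₁ z
    have h2 := hV.add_le hC₂ z
    have h3 := hquad q hq _ (hV z).1 z
    linarith
  have hUV₂ : ∀ q ∈ Metric.ball y₀ δ, ∀ z,
      U z + V z + α / 2 * ‖z - q‖ ^ 2 + κ * ‖z - Y' z‖ ^ 2 ≤ N := by
    intro q hq z
    have h1 := hU.add_le hC₁ z
    have h2 := hV.add_le hC₂ z
    have h3 := hquad q hq _ (hU z).1 z
    linarith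
  have hUC : ∀ x, U x ≤ C₁ := fun x => by
    have := hU.add_le hC₁ x
    have h2 : 0 ≤ κ * ‖x - Y x‖ ^ 2 := by positivity
    linarith
  have hVC : ∀ x, V x ≤ C₂ := fun x => by
    have := hV.add_le hC₂ x
    have h2 : 0 ≤ κ * ‖x - Y' x‖ ^ 2 := by positivity
    linarith
  obtain ⟨q, hq, x, p₁, p₂, T₁, T₂, hmax, hp, hT, hT₁, hT₂, hJ₁, hJ₂⟩ :=
    exists_max_point_with_jets (by positivity) hU.strongConvexOn hV.strongConvexOn hUC hVC hα0 hδ0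
      y₀ fun q hq => exists_forall_le_of_le_sub_sq
        (Ψ := fun z => U z + V z + α / 2 * ‖z - q‖ ^ 2)
        ((hU.continuous.add hV.continuous).add (by fun_prop)) hκ0
        (fun z => hYq q hq _ (hU z).1) (hUV₁ q hq)
  have hlow : η ≤ U x + V x + α / 2 * ‖x - q‖ ^ 2 := by
    have h1 := hmax x₁
    have h2 := hU.le_apply hx₁K ha
    have h3 := hV.le_apply hx₁K hb
    have h4 : 0 ≤ α / 2 * ‖x₁ - q‖ ^ 2 := by positivity
    linarith
  have hdist : ∀ y, U x + V x + α / 2 * ‖x - q‖ ^ 2 + κ * ‖x - y‖ ^ 2 ≤ N → ‖x - y‖ < δ := by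
    intro y hy
    refine lt_of_pow_lt_pow_left₀ 2 hδ0.le (lt_of_mul_lt_mul_left ?_ hκ0.le)
    linarith
  have hxY := hdist _ (hUV₁ q hq x)
  have hxY' := hdist _ (hUV₂ q hq x)
  have hYY' : dist (Y x) (Y' x) < 2 * δ := by
    have := dist_triangle_left (Y x) (Y' x) x
    rw [dist_eq_norm x, dist_eq_norm x] at this
    linarith
  have hxq : ‖x - q‖ ≤ R + 2 := by
    have h1 : ‖x - q‖ ≤ ‖x - Y x‖ + ‖Y x - q‖ := by simpa using norm_add_le (x - Y x) (Y x - q)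
    have h2 := hYq q hq _ (hU x).1
    linarith
  have hsq : α / 2 * ‖x - q‖ ^ 2 ≤ η / 2 := by
    have h1 : ‖x - q‖ ^ 2 ≤ (R + 2) ^ 2 := by gcongr
    have h2 : α * ((R + 2) ^ 2 / 2) ≤ α * m := by
      gcongr
      rw [hm]
      have : 0 ≤ γ * R := by positivity
      linarith
    have h3 := mul_le_mul_of_nonneg_left h1 (half_pos hα0).le
    linarith
  have hκY : 0 ≤ κ * ‖x - Y x‖ ^ 2 := by positivity
  have hκY' : 0 ≤ κ * ‖x - Y' x‖ ^ 2 := by positivity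
  have huv : ((η / 2 : ℝ) : EReal) ≤ u (Y x) + v (Y' x) := by
    rw [(hU x).2.1, (hV x).2.1, ← EReal.coe_add, EReal.coe_le_coe_iff]
    linarith
  have hball := hδ _ (hU x).1 _ (hV x).1 hYY' huv
  have hYΩ : Y x ∈ Ω := hball (Metric.mem_ball_self (by linarith))
  have hY'Ω : Y' x ∈ Ω := hball (by rw [Metric.mem_ball, dist_comm]; exact hYY')
  -- Moving from `x` to `Y x` and from `q` to `y₀` costs less than `δ` each, whence the radius `2 *
  -- δ`.
  have hxqΩ : x - q + y₀ ∈ Ω := by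
    refine hball ?_
    rw [mem_ball_iff_norm]
    have e : x - q + y₀ - Y x = (x - Y x) + (y₀ - q) := by abel
    have h2 : ‖y₀ - q‖ < δ := by rw [← dist_eq_norm, dist_comm]; exact hq
    rw [e]
    linarith [norm_add_le (x - Y x) (y₀ - q)]
  obtain ⟨hwD, hwR⟩ := hin _ hxqΩ
  rw [add_sub_cancel_right] at hwD hwR
  obtain ⟨A₁, rfl⟩ := exists_symMat_of_symmetric hT₁
  obtain ⟨A₂, rfl⟩ := exists_symMat_of_symmetric hT₂
  have hmem₁ := (hsubu _ hYΩ).mem_of_taylor hF (p := p₁) (A := A₁) (fun ε hε =>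
    hU.eventually_le_of_eventually_le (Filter.mem_of_superset (hΩ.mem_nhds hYΩ) subset_closure)
      (hJ₁ ε hε)) (hU x).2.1
  have hmem₂ := (hsubv _ hY'Ω).mem_of_taylor (isClosed_dirichletDual F) (p := p₂) (A := A₂)
    (fun ε hε => hV.eventually_le_of_eventually_le
      (Filter.mem_of_superset (hΩ.mem_nhds hY'Ω) subset_closure) (hJ₂ ε hε)) (hV x).2.1
  refine hmem₂ ?_
  -- This is minus the sum of the two test jets, by `hp`.
  have hint : ((-(U x + κ * ‖x - Y x‖ ^ 2) - (V x + κ * ‖x - Y' x‖ ^ 2), α • (x - q), -A₁ - A₂) :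
      Jet n) ∈ interior M := by
    refine interior_mono hM (mem_interior_coneGDR_of_quadratic hD hα0 hR hwD hwR ?_ fun h => ?_)
    · have h1 : α * ((R + 2) ^ 2 / 2 + γ * R) = η / 2 := by rw [← hm, hαm]
      have h2 : γ * ‖x - q‖ ≤ γ * R := by gcongr
      have h3 := mul_le_mul_of_nonneg_left h2 hα0.le
      have h4 : 0 < α * (R + 2) ^ 2 := by positivity
      linarith
    · have h1 := hT h
      have e : (((-A₁ - A₂ : SymMat n)) : Matrix (Fin n) (Fin n) ℝ) =
        -(A₁ : Matrix (Fin n) (Fin n) ℝ) - (A₂ : Matrix (Fin n) (Fin n) ℝ) := rfl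
      rw [e, map_sub, map_neg, sub_apply, neg_apply, inner_sub_right,
        inner_neg_right]
      linarith
  have := hFM.add_mem_interior hmem₁ hint
  convert this using 1
  refine Prod.ext ?_ (Prod.ext ?_ ?_)
  · simp only [Prod.fst_add, Prod.fst_neg]
    ring
  · simp only [Prod.snd_add, Prod.fst_add, Prod.snd_neg, Prod.fst_neg]
    have : α • (x - q) = -(p₁ + p₂) := by rw [hp, neg_smul, neg_neg]
    rw [this]
    abel
  · simp only [Prod.snd_add, Prod.snd_neg]
    abel

end Principles

/-! ### Fundamental cones inside a general monotonicity cone. -/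

section MonotonicityCones

variable {n : ℕ}

local notation "⟪" x ", " y "⟫" => inner ℝ x y

namespace IsMonotonicityConeSubequation

variable {M : Set (Jet n)}

theorem zero_mem (hM : IsMonotonicityConeSubequation M) : (0 : Jet n) ∈ M :=
  hM.minimal_subset ⟨le_rfl, rfl, Matrix.PosSemidef.zero⟩

theorem interior_nonempty (hM : IsMonotonicityConeSubequation M) : (interior M).Nonempty := by
  rw [← closure_nonempty_iff, ← hM.topological]
  exact ⟨0, hM.zero_mem⟩

theorem add_mem (hM : IsMonotonicityConeSubequation M) {J K : Jet n} (hJ : J ∈ M) (hK : K ∈ M) :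
    J + K ∈ M := by
  have h1 := hM.convex hJ hK (a := 1 / 2) (b := 1 / 2) (by norm_num) (by norm_num) (by norm_num)
  have h2 := hM.isCone 2 (by norm_num) _ h1
  rwa [smul_add, smul_smul, smul_smul, mul_one_div_cancel two_ne_zero, one_smul, one_smul] at h2

/-- Membership is preserved when `r` decreases and `A` increases. -/
theorem mem_of_le (hM : IsMonotonicityConeSubequation M) {r s : ℝ} {p : EuclideanSpace ℝ (Fin n)}
    {A B : SymMat n} (h : (r, p, A) ∈ M) (hs : s ≤ r)
    (hAB : ∀ h, ⟪h, Matrix.toEuclideanCLM (𝕜 := ℝ) (A : Matrix (Fin n) (Fin n) ℝ) h⟫ ≤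
      ⟪h, Matrix.toEuclideanCLM (𝕜 := ℝ) (B : Matrix (Fin n) (Fin n) ℝ) h⟫) : (s, p, B) ∈ M := by
  have h1 : ((s - r, 0, B - A) : Jet n) ∈ M := by
    refine hM.minimal_subset ⟨by simpa using hs, rfl,
      (posSemidef_iff_forall_inner (B - A).2).2 fun h => ?_⟩
    have e : ((B - A : SymMat n) : Matrix (Fin n) (Fin n) ℝ) =
      (B : Matrix (Fin n) (Fin n) ℝ) - (A : Matrix (Fin n) (Fin n) ℝ) := rfl
    change 0 ≤ ⟪h, Matrix.toEuclideanCLM (𝕜 := ℝ) ((B - A : SymMat n) :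
      Matrix (Fin n) (Fin n) ℝ) h⟫
    rw [e, map_sub, sub_apply, inner_sub_right]
    exact sub_nonneg.2 (hAB h)
  have h2 := hM.add_mem h h1
  have e : ((r, p, A) + (s - r, 0, B - A) : Jet n) = (s, p, B) := by simp
  rwa [e] at h2

/-- The gradients `p` for which `(-⟨p, e⟩, p, ⟨p, e⟩ I)` lies in `M`. -/
def gradientCone (M : Set (Jet n)) (e : EuclideanSpace ℝ (Fin n)) :
    Set (EuclideanSpace ℝ (Fin n)) :=
  {p | ((-⟪p, e⟫, p, ⟪p, e⟫ • symOne n) : Jet n) ∈ M}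

/-- The set is the preimage of `M` under a linear map of `p`. -/
theorem isDirectionalCone_gradientCone (hM : IsMonotonicityConeSubequation M)
    {e : EuclideanSpace ℝ (Fin n)} (he : (interior (gradientCone M e)).Nonempty) :
    IsDirectionalCone (gradientCone M e) where
  isClosed := hM.isClosed.preimage
    (by fun_prop : Continuous fun p : EuclideanSpace ℝ (Fin n) =>
      ((-⟪p, e⟫, p, ⟪p, e⟫ • symOne n) : Jet n))
  convex := by
    intro p hp q hq a b ha hb hab
    have h := hM.convex hp hq ha hb hab
    refine (congrArg (· ∈ M) ?_).mp h
    simp only [Prod.smul_mk, Prod.mk_add_mk, inner_add_left, inner_smul_left, conj_trivial,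
      smul_eq_mul]
    refine Prod.ext ?_ (Prod.ext rfl ?_)
    · simp only
      ring
    · simp only
      module
  isCone := by
    intro t ht p hp
    have h := hM.isCone t ht _ hp
    refine (congrArg (· ∈ M) ?_).mp h
    simp only [Prod.smul_mk, inner_smul_left, conj_trivial, smul_eq_mul]
    refine Prod.ext ?_ (Prod.ext rfl ?_)
    · simp only
      ring
    · simp only
      module
  interior_nonempty := he

/-- By Cauchy–Schwarz `⟪p, e⟫ ≤ γ ‖p‖`, so each jet has a smaller value and a larger Hessian than
the jet of the slice over the same `p`. -/
theorem coneGDR_gradientCone_subset (hM : IsMonotonicityConeSubequation M)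
    {e : EuclideanSpace ℝ (Fin n)} {γ : ℝ} (heγ : ‖e‖ ≤ γ) :
    coneGDR γ (gradientCone M e) γ⁻¹ ⊆ M := by
  rintro ⟨r, p, A⟩ ⟨⟨h1, h2⟩, h3⟩
  have hle : ⟪p, e⟫ ≤ γ * ‖p‖ := by
    calc ⟪p, e⟫ ≤ ‖p‖ * ‖e‖ := real_inner_le_norm _ _
      _ ≤ ‖p‖ * γ := by gcongr
      _ = γ * ‖p‖ := mul_comm _ _
  refine hM.mem_of_le (h2 : (-⟪p, e⟫, p, ⟪p, e⟫ • symOne n) ∈ M) ?_ fun h => ?_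
  · have : r ≤ -γ * ‖p‖ := h1
    linarith
  · have h4 : ‖p‖ / γ⁻¹ * ‖h‖ ^ 2 ≤ _ := mem_coneR_iff.1 h3 h
    rw [div_inv_eq_mul, mul_comm ‖p‖] at h4
    rw [inner_toEuclideanCLM_symOne]
    exact le_trans (by gcongr) h4

/-- Take an interior jet of `M` with gradient `p₀ ≠ 0` and let `e` be a large multiple of `p₀`. For
`p` near `p₀`, `⟪p, e⟫` exceeds both `|r₀|` and the norm of `A₀`, so `mem_of_le` applies. In
dimension zero there is no such `p₀`, and `e = 0` works. -/
theorem exists_interior_gradientCone_nonempty (hM : IsMonotonicityConeSubequation M) :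
    ∃ e, (interior (gradientCone M e)).Nonempty := by
  obtain ⟨⟨r₀, q₀, A₀⟩, hJ⟩ := hM.interior_nonempty
  rcases subsingleton_or_nontrivial (EuclideanSpace ℝ (Fin n)) with hsub | hnt
  · refine ⟨0, ?_⟩
    have : gradientCone M 0 = Set.univ := by
      refine Set.eq_univ_of_forall fun p => ?_
      obtain rfl := Subsingleton.elim p 0
      change ((-⟪(0 : EuclideanSpace ℝ (Fin n)), 0⟫, 0, ⟪(0 : EuclideanSpace ℝ (Fin n)), 0⟫ •
        symOne n) : Jet n) ∈ M
      rw [inner_zero_left, neg_zero, zero_smul]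
      exact hM.zero_mem
    rw [this, interior_univ]
    exact Set.univ_nonempty
  · set O : Set (EuclideanSpace ℝ (Fin n)) := {p | ((r₀, p, A₀) : Jet n) ∈ interior M} with hO
    have hOo : IsOpen O := isOpen_interior.preimage
      (by fun_prop : Continuous fun p : EuclideanSpace ℝ (Fin n) => ((r₀, p, A₀) : Jet n))
    have hne : (𝓝[≠] (0 : EuclideanSpace ℝ (Fin n))).NeBot := Module.punctured_nhds_neBot ℝ _ 0
    obtain ⟨p₀, hp₀O, hp₀⟩ := (dense_compl_singleton (0 : EuclideanSpace ℝ (Fin n))).inter_open_nonempty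
      O hOo ⟨q₀, hJ⟩
    have hpos : 0 < ‖p₀‖ ^ 2 := by
      have : p₀ ≠ 0 := hp₀
      positivity
    set T := Matrix.toEuclideanCLM (𝕜 := ℝ) (A₀ : Matrix (Fin n) (Fin n) ℝ) with hT
    set c := |r₀| + ‖T‖ + 1 with hc
    have hin : c - 1 < ⟪p₀, (c / ‖p₀‖ ^ 2) • p₀⟫ := by
      rw [inner_smul_right, real_inner_self_eq_norm_sq, div_mul_cancel₀ _ hpos.ne']
      linarith
    refine ⟨(c / ‖p₀‖ ^ 2) • p₀, p₀, mem_interior.2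
      ⟨O ∩ {p | c - 1 < ⟪p, (c / ‖p₀‖ ^ 2) • p₀⟫}, ?_,
        hOo.inter (isOpen_lt continuous_const (by fun_prop)), hp₀O, hin⟩⟩
    rintro p ⟨hpO, hp⟩
    have hp' : c - 1 < ⟪p, (c / ‖p₀‖ ^ 2) • p₀⟫ := hp
    refine hM.mem_of_le (interior_subset hpO) ?_ fun h => ?_
    · linarith [neg_abs_le r₀, norm_nonneg T]
    · rw [inner_toEuclideanCLM_symOne]
      calc ⟪h, T h⟫ ≤ ‖h‖ * ‖T h‖ := real_inner_le_norm _ _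
        _ ≤ ‖h‖ * (‖T‖ * ‖h‖) := by gcongr; exact T.le_opNorm h
        _ = ‖T‖ * ‖h‖ ^ 2 := by ring
        _ ≤ _ := by
          gcongr
          linarith [abs_nonneg r₀]

/-- Every monotonicity cone subequation contains a cone `𝓜(γ, 𝒟, R)` with finite `R`. -/
theorem exists_coneGDR_subset (hM : IsMonotonicityConeSubequation M) :
    ∃ (γ : ℝ) (D : Set (EuclideanSpace ℝ (Fin n))) (R : ℝ),
      0 < γ ∧ IsDirectionalCone D ∧ 0 < R ∧ coneGDR γ D R ⊆ M := by
  obtain ⟨e, he⟩ := hM.exists_interior_gradientCone_nonempty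
  have hγ : 0 < ‖e‖ + 1 := by positivity
  exact ⟨‖e‖ + 1, gradientCone M e, (‖e‖ + 1)⁻¹, hγ, hM.isDirectionalCone_gradientCone he,
    inv_pos.2 hγ, hM.coneGDR_gradientCone_subset (by linarith)⟩

end IsMonotonicityConeSubequation

end MonotonicityCones

/-! ### Assembly. -/

theorem mainTheorem5 (n : ℕ) :
    -- Comparison, cases 1) and 2)
    (∀ F M : Set (Jet n), IsSubequation F → IsMonotonicityConeSubequation M →
      IsMonotoneFor F M →
      (∀ (γ : ℝ) (D : Set (EuclideanSpace ℝ (Fin n))) (R : ℝ),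
        0 ≤ γ → IsDirectionalCone D → 0 < R → coneGDR γ D R ⊆ M →
        ∀ Ω : Set (EuclideanSpace ℝ (Fin n)), IsOpen Ω → InTranslateOfTruncatedCone Ω D R →
          ComparisonPrinciple F Ω) ∧
      (∀ (γ : ℝ) (D : Set (EuclideanSpace ℝ (Fin n))),
        0 ≤ γ → IsDirectionalCone D → coneGDP γ D ⊆ M →
        ∀ Ω : Set (EuclideanSpace ℝ (Fin n)), IsOpen Ω → Bornology.IsBounded Ω →
          ComparisonPrinciple F Ω)) ∧
    -- Every monotonicity cone subequation contains a cone as in case 1)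
    (∀ M : Set (Jet n), IsMonotonicityConeSubequation M →
      ∃ (γ : ℝ) (D : Set (EuclideanSpace ℝ (Fin n))) (R : ℝ),
        0 < γ ∧ IsDirectionalCone D ∧ 0 < R ∧ coneGDR γ D R ⊆ M) ∧
    -- The cones of case 2) contain those of case 1)
    (∀ (γ : ℝ) (D : Set (EuclideanSpace ℝ (Fin n))) (R : ℝ),
      0 ≤ γ → IsDirectionalCone D → 0 < R → coneGDR γ D R ⊆ coneGDP γ D) ∧
    -- Zero maximum principle, R finite: for the cone and for anything larger
    (∀ (γ : ℝ) (D : Set (EuclideanSpace ℝ (Fin n))) (R : ℝ),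
      0 ≤ γ → IsDirectionalCone D → 0 < R →
      ∀ M : Set (Jet n), coneGDR γ D R ⊆ M →
      ∀ Ω : Set (EuclideanSpace ℝ (Fin n)), IsOpen Ω → InTranslateOfTruncatedCone Ω D R →
        ZeroMaximumPrinciple (dirichletDual M) Ω) ∧
    -- Zero maximum principle, R infinite: for the cone and for anything larger
    (∀ (γ : ℝ) (D : Set (EuclideanSpace ℝ (Fin n))),
      0 ≤ γ → IsDirectionalCone D →
      ∀ M : Set (Jet n), coneGDP γ D ⊆ M →
      ∀ Ω : Set (EuclideanSpace ℝ (Fin n)), IsOpen Ω → Bornology.IsBounded Ω →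
        ZeroMaximumPrinciple (dirichletDual M) Ω) := by
  refine ⟨fun F M hF _ hFM => ⟨?_, ?_⟩, fun M hM => hM.exists_coneGDR_subset,
    fun γ D R _ _ hR => coneGDR_subset_coneGDP D hR, ?_, ?_⟩
  · intro γ D R hγ hD hR hsub Ω hΩ hΩD
    exact comparisonPrinciple_of_coneGDR_subset hγ hD hR hF.isClosed hFM hsub hΩ hΩD
  · intro γ D hγ hD hsub Ω hΩ hb
    -- `𝓜(γ, 𝒟, 𝒫)` contains `𝓜(γ, 𝒟, R)` for every `R > 0`, so the radius may be chosen after `Ω`.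
    obtain ⟨R, hR, hΩD⟩ := hD.exists_inTranslateOfTruncatedCone hb
    exact comparisonPrinciple_of_coneGDR_subset hγ hD hR hF.isClosed hFM
      ((coneGDR_subset_coneGDP D hR).trans hsub) hΩ hΩD
  · intro γ D R hγ hD hR M hsub Ω hΩ hΩD
    exact zeroMaximumPrinciple_of_coneGDR_subset hγ hD hR hsub hΩ hΩD
  · intro γ D hγ hD M hsub Ω hΩ hb
    obtain ⟨R, hR, hΩD⟩ := hD.exists_inTranslateOfTruncatedCone hb
    exact zeroMaximumPrinciple_of_coneGDR_subset hγ hD hR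
      ((coneGDR_subset_coneGDP D hR).trans hsub) hΩ hΩD
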